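/- Let $n\ge 1$ and let $\mathcal G_*=(\mathcal V,\mathcal E_*)$ be a directed graph without self-loops on $\mathcal V=\{1,\dots,n\}$. Each arc $(j,i)\in\mathcal E_*$ (from $j$ to $i$) carries a weight $W_{ij}:[0,\infty)\to[0,\infty)$. Put $\mathcal N_i=\{i\}\cup\{j:(j,i)\in\mathcal E_*\}$ and, for initial times $t_0\ge 0$ and initial values $x(t_0)\in\mathbb R^n$, consider $$\dot x_i(t)=\sum_{j\in\mathcal N_i}W_{ij}(t)\,[x_j(t)-x_i(t)],\qquad i=1,\dots,n, \tag{1}$$ with solutions on $[t_0,\infty)$ in the sense of Carathéodory (locally absolutely continuous, satisfying (1) for almost every $t$). Let $\mathcal H(t)=\max_i x_i(t)-\min_i x_i(t)$. *Global $\epsilon$-agreement* is achieved if there are constants $0<\epsilon<1$ and $T_0>0$ such that, for all $t_0\ge0$ and all $x(t_0)\in\mathbb R^n$, $\mathcal H(t+T_0)\le\epsilon\,\mathcal H(t)$ for all $t\ge t_0$. An arc $(j,i)\in\mathcal E_*$ is *persistent* if $\int_s^\infty W_{ij}(t)\,dt=\infty$ for all $s\ge0$; $\mathcal E^p$ is the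 set of persistent arcs and $\mathcal G^p=(\mathcal V,\mathcal E^p)$. A digraph is *quasi-strongly connected* if it has a node from which every node is reachable by a directed path (each node being reachable from itself). Let $d_0$ be the diameter of $\mathcal G^p$, that is, the maximum of the length of a shortest directed path from $i$ to $j$ over all pairs $i,j$ with $j$ reachable from $i$ in $\mathcal G^p$. Assume: * (A3, arc balance) there is a constant $A>1$ such that $A^{-1}W_{ij}(t)\le W_{km}(t)\le A\,W_{ij}(t)$ for any two arcs $(j,i),(m,k)\in\mathcal E^p$ and all $t\ge0$; * (A4, continuity) each $W_{ij}$ with $(j,i)\in\mathcal E_*$ is continuous except on a set of measure zero, and it is integrable on bounded intervals. **Theorem.** Global $\epsilon$-agreement is achieved for (1) if and only if (a) $\mathcal G^p$ is quasi-strongly connected; and (b) there are constants $a_*,\tau_0>0$ such that $\int_t^{t+\tau_0}W_{ij}(s)\,ds\ge a_*$ for all $t\ge0$ and all $(j,i)\in\mathcal E^p$. Moreover, if (a) holds and (b) holds with the constants $a_*,\tau_0$, then for all $t_0\ge0$, every solution of (1) on $[t_0,\infty)$ and all $t\ge t_0$, $$\mathcal H\Big(t+\tau_0\Big\lceil\frac{d_0\log2}{a_*}\Big\rceil\Big)\le\Big(1-\frac{m_0^{d_0}}2\Big)\mathcal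 H(t),$$ where $m_0=\big(\frac{\omega_0}2\big)^2\frac1{(n-1)A}$, $\omega_0=e^{-\int_0^\infty\theta(t)\,dt}$ and $\theta(t)=\sum_{(j,i)\in\mathcal E_*\setminus\mathcal E^p}W_{ij}(t)$ (for $n=1$, where $d_0=0$, $m_0^{d_0}$ is read as $1$). -/

import Mathlib

open MeasureTheory Set

/-! ### Digraphs: walks, reachability, centers, distance, diameter -/

/-- There is a directed walk with exactly `k` arcs from `i` to `j`. -/
def Digraph.HasWalk {V : Type*} (G : Digraph V) (k : ℕ) (i j : V) : Prop :=
  ∃ p : ℕ → V, p 0 = i ∧ p k = j ∧ ∀ m < k, G.Adj (p m) (p (m + 1))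

/-- `j` is reachable from `i`; every node is reachable from itself (walk with no arc). -/
def Digraph.Reachable {V : Type*} (G : Digraph V) (i j : V) : Prop :=
  ∃ k, G.HasWalk k i j

/-- `G` has a center (root): a node from which every node is reachable. -/
def Digraph.QuasiStronglyConnected {V : Type*} (G : Digraph V) : Prop :=
  ∃ c, ∀ j, G.Reachable c j

/-- Length of a shortest directed path from `i` to `j` (a walk of minimal length is a simple
path). Only used for `j` reachable from `i`. -/
noncomputable def Digraph.distance {V : Type*} (G : Digraph V) (i j : V) : ℕ :=
  sInf {k | G.HasWalk k i j}

open Classical in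
/-- The maximum of the distances `d(i,j)` over all pairs with `j` reachable from `i`. -/
noncomputable def Digraph.diameter {V : Type*} [Fintype V] (G : Digraph V) : ℕ :=
  (Finset.univ.filter fun p : V × V => G.Reachable p.1 p.2).sup fun p => G.distance p.1 p.2

/-! ### The network model -/

/-- A social network on the nodes `Fin n`: a simple (loopless) underlying digraph and a
nonnegative time-dependent weight on each arc. The number `weight i j t` is the weight, at
time `t ≥ 0`, of the arc `(j, i)` from `j` to `i`; its values at negative times, or when
`(j, i)` is not an arc, are irrelevant. -/
structure SocialNetwork (n : ℕ) where
  graph : Digraph (Fin n)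
  loopless : ∀ i, ¬ graph.Adj i i
  weight : Fin n → Fin n → ℝ → ℝ
  weight_nonneg : ∀ i j, graph.Adj j i → ∀ t, 0 ≤ t → 0 ≤ weight i j t

/-- The agreement measure `max_i x_i - min_i x_i` of a vector of beliefs. -/
noncomputable def beliefSpread {n : ℕ} (x : Fin n → ℝ) : ℝ :=
  (⨆ i, x i) - ⨅ i, x i

namespace SocialNetwork

open Classical in
/-- The neighbors of `i`: `i` itself and the tails of the arcs entering `i`. -/
noncomputable def neighbors {n : ℕ} (N : SocialNetwork n) (i : Fin n) : Finset (Fin n) :=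
  Finset.univ.filter fun j => j = i ∨ N.graph.Adj j i

/-- `x` is a Caratheodory solution on `[t₀, ∞)` of
`x_i' = ∑_{j ∈ N_i} W_ij(t) (x_j - x_i)`: it is absolutely continuous on compact intervals
and satisfies the equation at almost every time. -/
def IsSolution {n : ℕ} (N : SocialNetwork n) (t₀ : ℝ) (x : ℝ → Fin n → ℝ) : Prop :=
  (∀ i, ∀ T, t₀ ≤ T → AbsolutelyContinuousOnInterval (fun t => x t i) t₀ T) ∧
  ∀ᵐ t ∂(volume.restrict (Ici t₀)), ∀ i,
    HasDerivAt (fun s => x s i) (∑ j ∈ N.neighbors i, N.weight i j t * (x t j - x t i)) t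

/-- Global `ε`-agreement: the constants `ε` and `T₀` serve all initial times `t₀ ≥ 0` and all
initial beliefs. -/
def GlobalEpsAgreement {n : ℕ} (N : SocialNetwork n) : Prop :=
  ∃ ε T₀ : ℝ, 0 < ε ∧ ε < 1 ∧ 0 < T₀ ∧
    ∀ t₀, 0 ≤ t₀ → ∀ x : ℝ → Fin n → ℝ, N.IsSolution t₀ x →
      ∀ t, t₀ ≤ t → beliefSpread (x (t + T₀)) ≤ ε * beliefSpread (x t)

/-- The persistent graph: the arcs `(j, i)` of the underlying graph with
`∫_s^∞ W_ij(t) dt = ∞` for all `s ≥ 0`. -/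
def persistentGraph {n : ℕ} (N : SocialNetwork n) : Digraph (Fin n) where
  Adj j i := N.graph.Adj j i ∧
    ∀ s : ℝ, 0 ≤ s → ∫⁻ t in Ici s, ENNReal.ofReal (N.weight i j t) = ⊤

/-- Arc balance with constant `A`, for any two arcs `(j, i)`, `(m, k)` of the persistent graph. -/
def ArcBalance {n : ℕ} (N : SocialNetwork n) (A : ℝ) : Prop :=
  ∀ i j k m, N.persistentGraph.Adj j i → N.persistentGraph.Adj m k → ∀ t, 0 ≤ t →
    A⁻¹ * N.weight i j t ≤ N.weight k m t ∧ N.weight k m t ≤ A * N.weight i j t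

/-- Each arc weight is continuous on `[0, ∞)` except on a set of measure zero. -/
def AEContinuous {n : ℕ} (N : SocialNetwork n) : Prop :=
  ∀ i j, N.graph.Adj j i →
    ∀ᵐ t ∂(volume.restrict (Ici (0 : ℝ))), ContinuousWithinAt (N.weight i j) (Ici 0) t

/-- Each arc weight is integrable on bounded subintervals of `[0, ∞)`. -/
def LocallyIntegrableWeights {n : ℕ} (N : SocialNetwork n) : Prop :=
  ∀ i j, N.graph.Adj j i → LocallyIntegrableOn (N.weight i j) (Ici 0)

/-- `∫_t^{t+τ₀} W_ij(s) ds ≥ a` for all `t ≥ 0` and all persistent arcs `(j, i)`. -/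
def UniformlyPersistent {n : ℕ} (N : SocialNetwork n) (a τ₀ : ℝ) : Prop :=
  ∀ i j, N.persistentGraph.Adj j i → ∀ t, 0 ≤ t → a ≤ ∫ s in t..(t + τ₀), N.weight i j s

open Classical in
/-- `θ(t)`: the total weight at time `t` of the non-persistent arcs. -/
noncomputable def theta {n : ℕ} (N : SocialNetwork n) (t : ℝ) : ℝ :=
  ∑ p ∈ Finset.univ.filter (fun p : Fin n × Fin n =>
      N.graph.Adj p.1 p.2 ∧ ¬ N.persistentGraph.Adj p.1 p.2),
    N.weight p.2 p.1 t

/-- The integral in the definition of `omega` below is a genuine one. -/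
theorem integrableOn_theta {n : ℕ} (N : SocialNetwork n) (h : N.LocallyIntegrableWeights) :
    IntegrableOn N.theta (Ioi 0) := by
  classical
  refine integrable_finsetSum _ fun p hp => ?_
  simp only [Finset.mem_filter, Finset.mem_univ, true_and] at hp
  obtain ⟨hG, hP⟩ := hp
  have hloc := h p.2 p.1 hG
  have hex : ∃ s : ℝ, 0 ≤ s ∧ ∫⁻ t in Ici s, ENNReal.ofReal (N.weight p.2 p.1 t) ≠ ⊤ := by
    by_contra hcon
    push Not at hcon
    exact hP ⟨hG, hcon⟩
  obtain ⟨s, hs, hfin⟩ := hex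
  have h1 : IntegrableOn (N.weight p.2 p.1) (Icc 0 s) :=
    hloc.integrableOn_compact_subset Icc_subset_Ici_self isCompact_Icc
  have h2 : IntegrableOn (N.weight p.2 p.1) (Ici s) := by
    refine ⟨hloc.aestronglyMeasurable.mono_set (Ici_subset_Ici.2 hs), ?_⟩
    rw [hasFiniteIntegral_iff_ofReal]
    · exact lt_top_iff_ne_top.2 hfin
    · filter_upwards [ae_restrict_mem measurableSet_Ici] with t ht
      exact N.weight_nonneg _ _ hG t (hs.trans ht)
  refine (h1.union h2).mono_set fun t ht => ?_
  rcases le_total t s with hts | hts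
  · exact Or.inl ⟨le_of_lt ht, hts⟩
  · exact Or.inr hts

/-- `ω₀ = exp (-∫_0^∞ θ(t) dt)`. -/
noncomputable def omega {n : ℕ} (N : SocialNetwork n) : ℝ :=
  Real.exp (-∫ t in Ioi (0 : ℝ), N.theta t)

/-- `m₀ = (ω₀ / 2)² / ((n - 1) A)`; for `n = 1` it only occurs to the power zero. -/
noncomputable def mZero {n : ℕ} (N : SocialNetwork n) (A : ℝ) : ℝ :=
  (N.omega / 2) ^ 2 * (1 / (((n : ℝ) - 1) * A))

end SocialNetwork

/-! ### Absolutely continuous functions -/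

/-! The equation is cooperative: the weights are nonnegative, so a family `v` whose derivatives are
at most the right-hand side, and which starts below a solution, stays below it (`subsolution_le`).
Every estimate comes from a choice of subsolution.

Necessity. Give the value 1 to a set `S₁` and 0 to the other nodes. If the inflow into `S₁` and into
a disjoint set `S₂` is at most `g`, both sets keep their values up to a factor `exp (-∫ g)`, so the
spread stays at least `1 - 2 ∫ g` (`exists_separated_solution`). If the persistent graph has no
root, it has two disjoint sets that no persistent arc enters, and late in time `g = θ` has small
integral, which contradicts contraction. If some persistent arc is weak on a long window, arc
balance makes all of them weak there, and two single nodes stay apart.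

Sufficiency. Let `w` be the lowest persistent weight and measure time by `τ = ∫ w`. Consider a chain
of states `0, …, d`: mass 1 starts in state 0, moves one state forward at rate 1, leaks from each
state below `d` at rate `(n - 1) A`, and is absorbed in state `d`. With `r = (n - 1) A + 1`, the
mass in state `k < d` is `τ ^ k / k! * exp (-r τ)`. The mass in the states from `l` on, times `exp
(-∫ θ)`, is a subsolution at the nodes of depth `l` below a root: the parent supplies the forward
flow, the leak pays for the at most `n - 1` persistent arcs, and the exponential pays for the
others. Hence every node keeps at least the absorbed mass (`absorbedMass_le`), which is at least `(2
r)⁻ᵈ` once `r τ ≥ d log 2` (`le_absorbedMass`). Applied to `x - min x` or `max x - x`, whichever is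
at least half the spread at the root, this gives the contraction. -/

theorem LipschitzOnWith.comp_absolutelyContinuousOnInterval {f g : ℝ → ℝ} {a b : ℝ}
    {K : NNReal} {s : Set ℝ} (hg : LipschitzOnWith K g s)
    (hf : AbsolutelyContinuousOnInterval f a b) (hs : MapsTo f (uIcc a b) s) :
    AbsolutelyContinuousOnInterval (fun t => g (f t)) a b := by
  rw [absolutelyContinuousOnInterval_iff] at hf ⊢
  intro ε hε
  obtain ⟨δ, hδ, h⟩ := hf (ε / (K + 1)) (by positivity)
  refine ⟨δ, hδ, fun E hE hlt => ?_⟩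
  calc ∑ i ∈ Finset.range E.1, dist (g (f (E.2 i).1)) (g (f (E.2 i).2))
      ≤ ∑ i ∈ Finset.range E.1, K * dist (f (E.2 i).1) (f (E.2 i).2) :=
        Finset.sum_le_sum fun i hi =>
          hg.dist_le_mul _ (hs (hE.1 i hi).1) _ (hs (hE.1 i hi).2)
    _ = K * ∑ i ∈ Finset.range E.1, dist (f (E.2 i).1) (f (E.2 i).2) := by
        rw [Finset.mul_sum]
    _ ≤ K * (ε / (K + 1)) := by gcongr; exact (h E hE hlt).le
    _ < (K + 1) * (ε / (K + 1)) := by gcongr; linarith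
    _ = ε := by field_simp

theorem ContDiff.comp_absolutelyContinuousOnInterval {f g : ℝ → ℝ} {a b : ℝ}
    (hg : ContDiff ℝ 1 g) (hf : AbsolutelyContinuousOnInterval f a b) :
    AbsolutelyContinuousOnInterval (fun t => g (f t)) a b := by
  obtain ⟨C, hC⟩ := hf.exists_bound
  obtain ⟨K, hK⟩ := hg.contDiffOn.exists_lipschitzOnWith (by decide) (convex_Icc (-C) C)
    isCompact_Icc
  exact hK.comp_absolutelyContinuousOnInterval hf fun t ht => abs_le.1 (hC t ht)

theorem absolutelyContinuousOnInterval_const (c a b : ℝ) :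
    AbsolutelyContinuousOnInterval (fun _ => c) a b :=
  ContDiffOn.absolutelyContinuousOnInterval contDiffOn_const

theorem AbsolutelyContinuousOnInterval.congr_on {f g : ℝ → ℝ} {a b : ℝ}
    (hf : AbsolutelyContinuousOnInterval f a b) (h : EqOn f g (uIcc a b)) :
    AbsolutelyContinuousOnInterval g a b := by
  rw [absolutelyContinuousOnInterval_iff] at hf ⊢
  intro ε hε
  obtain ⟨δ, hδ, hE⟩ := hf ε hε
  refine ⟨δ, hδ, fun E hmem hlt => lt_of_eq_of_lt ?_ (hE E hmem hlt)⟩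
  refine Finset.sum_congr rfl fun i hi => ?_
  rw [h (hmem.1 i hi).1, h (hmem.1 i hi).2]

theorem AbsolutelyContinuousOnInterval.le_of_ae_hasDerivAt_nonneg {f f' : ℝ → ℝ} {a b : ℝ}
    (hab : a ≤ b) (hf : AbsolutelyContinuousOnInterval f a b)
    (h : ∀ᵐ s, s ∈ Ioc a b → HasDerivAt f (f' s) s ∧ 0 ≤ f' s) : f a ≤ f b := by
  rw [← sub_nonneg, ← hf.integral_deriv_eq_sub, intervalIntegral.integral_of_le hab]
  refine integral_nonneg_of_ae ?_
  filter_upwards [(ae_restrict_iff' measurableSet_Ioc).2 h] with s hs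
  rw [hs.1.deriv]
  exact hs.2

theorem AbsolutelyContinuousOnInterval.integral_eq_sub_of_ae_hasDerivAt {f f' : ℝ → ℝ} {a b : ℝ}
    (hab : a ≤ b) (hf : AbsolutelyContinuousOnInterval f a b)
    (h : ∀ᵐ s, s ∈ Ioc a b → HasDerivAt f (f' s) s) : ∫ s in a..b, f' s = f b - f a := by
  rw [← hf.integral_deriv_eq_sub]
  refine intervalIntegral.integral_congr_ae ?_
  rw [uIoc_of_le hab]
  filter_upwards [h] with s hs hmem
  exact (hs hmem).deriv.symm

/-! ### Comparison for cooperative linear differential inequalities -/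

/-- At a first time `c` where some `z i` fails to be positive, all components have been positive
before. So `z i' + (∑ W i j) z i ≥ 0` almost everywhere up to `c`, and `exp (∫ ∑ W i j) * z i` is
nondecreasing, hence positive at `c`. -/
theorem cooperative_pos_of_initial_pos {ι : Type*} [Fintype ι] {a b : ℝ} (hab : a ≤ b)
    {W : ι → ι → ℝ → ℝ} (hW : ∀ i j, ∀ s ∈ Icc a b, 0 ≤ W i j s)
    (hWi : ∀ i j, IntervalIntegrable (W i j) volume a b) {z z' : ι → ℝ → ℝ}
    (hz : ∀ i, AbsolutelyContinuousOnInterval (z i) a b)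
    (hz' : ∀ i, ∀ᵐ s, s ∈ Ioc a b → HasDerivAt (z i) (z' i s) s ∧
      ∑ j, W i j s * (z j s - z i s) ≤ z' i s)
    (h0 : ∀ i, 0 < z i a) : ∀ s ∈ Icc a b, ∀ i, 0 < z i s := by
  by_contra hcon
  push Not at hcon
  set S : Set ℝ := {s ∈ Icc a b | ∃ i, z i s ≤ 0} with hS
  have hSne : S.Nonempty := by
    obtain ⟨s, hs, i, hi⟩ := hcon
    exact ⟨s, hs, i, hi⟩
  have hScl : IsClosed S := by
    have : S = ⋃ i, (Icc a b ∩ (z i) ⁻¹' Iic 0) := by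
      ext s
      simp [hS]
    rw [this]
    refine isClosed_iUnion_of_finite fun i => ?_
    have hc := (hz i).continuousOn
    rw [uIcc_of_le hab] at hc
    exact hc.preimage_isClosed_of_isClosed isClosed_Icc isClosed_Iic
  have hSbd : BddBelow S := ⟨a, fun s hs => hs.1.1⟩
  set c := sInf S with hc
  obtain ⟨⟨hac, hcb⟩, i, hi⟩ : c ∈ S := hScl.csInf_mem hSne hSbd
  have hlt : ∀ s, a ≤ s → s < c → ∀ j, 0 < z j s := by
    intro s has hsc j
    by_contra hj
    exact absurd (csInf_le hSbd (show s ∈ S from ⟨⟨has, hsc.le.trans hcb⟩, j, not_lt.1 hj⟩))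
      (not_le.2 hsc)
  have hsub : uIcc a c ⊆ uIcc a b := by
    rw [uIcc_of_le hac, uIcc_of_le hab]
    exact Icc_subset_Icc_right hcb
  have hrow : IntervalIntegrable (fun s => ∑ j, W i j s) volume a c := by
    refine IntervalIntegrable.mono_set ?_ hsub
    simpa [Finset.sum_fn] using IntervalIntegrable.sum (Finset.univ)
      (f := fun j s => W i j s) fun j _ => hWi i j
  set F : ℝ → ℝ := fun s => ∫ u in a..s, ∑ j, W i j u with hF
  have hFac : AbsolutelyContinuousOnInterval F a c :=
    hrow.absolutelyContinuousOnInterval_intervalIntegral left_mem_uIcc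
  have hexp : AbsolutelyContinuousOnInterval (fun s => Real.exp (F s)) a c :=
    Real.contDiff_exp.comp_absolutelyContinuousOnInterval hFac
  have hprod : AbsolutelyContinuousOnInterval (fun s => Real.exp (F s) * z i s) a c :=
    hexp.fun_mul ((hz i).mono hsub)
  -- Positivity of all components is known only strictly before `c`.
  have hne : ∀ᵐ s : ℝ, s ≠ c := by simp [ae_iff, measure_singleton]
  have key := hprod.le_of_ae_hasDerivAt_nonneg (f' := fun s =>
      Real.exp (F s) * (∑ j, W i j s) * z i s + Real.exp (F s) * z' i s) hac (by
    filter_upwards [hrow.ae_hasDerivAt_integral, hz' i, hne] with s h1 h2 h3 hs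
    have hsc : s < c := lt_of_le_of_ne hs.2 h3
    have hsI : s ∈ uIcc a c := by rw [uIcc_of_le hac]; exact ⟨hs.1.le, hs.2⟩
    have hsb : s ∈ Ioc a b := ⟨hs.1, hs.2.trans hcb⟩
    refine ⟨((h1 hsI a left_mem_uIcc).exp).mul (h2 hsb).1, ?_⟩
    have hle := (h2 hsb).2
    have hnn : 0 ≤ ∑ j, W i j s * z j s := Finset.sum_nonneg fun j _ =>
      mul_nonneg (hW i j s ⟨hsb.1.le, hsb.2⟩) (hlt s hs.1.le hsc j).le
    have hsplit : ∑ j, W i j s * (z j s - z i s)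
        = ∑ j, W i j s * z j s - (∑ j, W i j s) * z i s := by
      rw [Finset.sum_mul, ← Finset.sum_sub_distrib]
      exact Finset.sum_congr rfl fun j _ => by ring
    rw [mul_assoc, ← mul_add]
    exact mul_nonneg (Real.exp_pos _).le (by linarith))
  have h1 : Real.exp (F a) * z i a > 0 := mul_pos (Real.exp_pos _) (h0 i)
  have h2 : Real.exp (F c) * z i c ≤ 0 :=
    mul_nonpos_of_nonneg_of_nonpos (Real.exp_pos _).le hi
  linarith

/-- The inequality involves only differences, so it survives adding a constant `ε > 0` to every
component; then `ε` tends to 0. -/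
theorem cooperative_nonneg_of_initial_nonneg {ι : Type*} [Fintype ι] {a b : ℝ} (hab : a ≤ b)
    {W : ι → ι → ℝ → ℝ} (hW : ∀ i j, ∀ s ∈ Icc a b, 0 ≤ W i j s)
    (hWi : ∀ i j, IntervalIntegrable (W i j) volume a b) {z z' : ι → ℝ → ℝ}
    (hz : ∀ i, AbsolutelyContinuousOnInterval (z i) a b)
    (hz' : ∀ i, ∀ᵐ s, s ∈ Ioc a b → HasDerivAt (z i) (z' i s) s ∧
      ∑ j, W i j s * (z j s - z i s) ≤ z' i s)
    (h0 : ∀ i, 0 ≤ z i a) : ∀ s ∈ Icc a b, ∀ i, 0 ≤ z i s := by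
  intro s hs i
  refine le_of_forall_pos_le_add fun ε hε => ?_
  refine (cooperative_pos_of_initial_pos (z := fun i s => z i s + ε) (z' := z') hab hW hWi
    (fun i => (hz i).fun_add (absolutelyContinuousOnInterval_const ε a b)) (fun i => ?_)
    (fun i => by linarith [h0 i]) s hs i).le
  filter_upwards [hz' i] with u hu hmem
  refine ⟨(hu hmem).1.add_const ε, ?_⟩
  simpa using (hu hmem).2

/-! ### Linear Caratheodory equations -/

/-- The integrand is almost everywhere the derivative of a power of the primitive. This is the
source of the factorials in the Picard bound when the coefficient is merely integrable. -/
theorem integral_mul_pow_primitive {l : ℝ → ℝ} {a b : ℝ} (hab : a ≤ b)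
    (hl : IntervalIntegrable l volume a b) (k : ℕ) :
    ∫ u in a..b, l u * (∫ r in a..u, l r) ^ k = (∫ r in a..b, l r) ^ (k + 1) / (k + 1) := by
  have hac := hl.absolutelyContinuousOnInterval_intervalIntegral (c := a) left_mem_uIcc
  have hpow : AbsolutelyContinuousOnInterval
      (fun s => (∫ r in a..s, l r) ^ (k + 1) / (k + 1)) a b :=
    ContDiff.comp_absolutelyContinuousOnInterval (g := fun y => y ^ (k + 1) / ((k : ℝ) + 1))
      ((contDiff_id.pow _).div_const _) hac
  rw [hpow.integral_eq_sub_of_ae_hasDerivAt hab]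
  · simp
  · filter_upwards [hl.ae_hasDerivAt_integral] with s hs hmem
    have hsI : s ∈ uIcc a b := by rw [uIcc_of_le hab]; exact ⟨hmem.1.le, hmem.2⟩
    have := ((hs hsI a left_mem_uIcc).pow (k + 1)).div_const ((k : ℝ) + 1)
    refine this.congr_deriv ?_
    have : (k : ℝ) + 1 ≠ 0 := by positivity
    push_cast
    field_simp

section LinearODE

variable {E : Type*} [NormedAddCommGroup E] [NormedSpace ℝ E]

/-- The Picard iterates of the linear equation `x' = L(t) x`, `x(a) = v`, arranged as the terms of
a series that sums to the solution. -/
noncomputable def picardTerm (L : ℝ → E →L[ℝ] E) (a : ℝ) (v : E) : ℕ → ℝ → E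
  | 0 => fun _ => v
  | k + 1 => fun s => ∫ u in a..s, L u (picardTerm L a v k u)

theorem IntervalIntegrable.clm_apply_continuousOn {L : ℝ → E →L[ℝ] E} {a b : ℝ}
    (hL : IntervalIntegrable L volume a b) {f : ℝ → E} (hf : ContinuousOn f (uIcc a b)) :
    IntervalIntegrable (fun u => L u (f u)) volume a b := by
  obtain ⟨C, hC⟩ := isCompact_uIcc.exists_bound_of_continuousOn hf
  rw [intervalIntegrable_iff] at hL ⊢
  refine Integrable.mono' (hL.norm.mul_const C) ?_ ?_
  · exact (ContinuousLinearMap.id ℝ (E →L[ℝ] E)).aestronglyMeasurable_comp₂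
      hL.aestronglyMeasurable
      (hf.aestronglyMeasurable_of_subset_isCompact isCompact_uIcc measurableSet_uIoc
        uIoc_subset_uIcc)
  · filter_upwards [ae_restrict_mem measurableSet_uIoc] with u hu
    exact (L u).le_of_opNorm_le_of_le le_rfl (hC u (uIoc_subset_uIcc hu))

variable {L : ℝ → E →L[ℝ] E}

theorem continuous_picardTerm (hL : ∀ a b, IntervalIntegrable L volume a b) (a : ℝ) (v : E)
    (k : ℕ) : Continuous (picardTerm L a v k) := by
  induction k with
  | zero => exact continuous_const
  | succ k ih =>
    exact intervalIntegral.continuous_primitive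
      (fun c d => (hL c d).clm_apply_continuousOn ih.continuousOn) a

theorem norm_picardTerm_le (hL : ∀ a b, IntervalIntegrable L volume a b) (a : ℝ) (v : E)
    (k : ℕ) : ∀ s, a ≤ s →
    ‖picardTerm L a v k s‖ ≤ ‖v‖ * ((∫ u in a..s, ‖L u‖) ^ k / (Nat.factorial k : ℝ)) := by
  induction k with
  | zero => intro s _; simp [picardTerm]
  | succ k ih =>
    intro s hs
    have hn : IntervalIntegrable (fun u => ‖L u‖) volume a s := (hL a s).norm
    have hcont : ContinuousOn (fun u => (∫ r in a..u, ‖L r‖) ^ k) (uIcc a s) :=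
      (intervalIntegral.continuous_primitive (fun c d => (hL c d).norm) a).continuousOn.pow k
    have hint : IntervalIntegrable (fun u => ‖L u‖ * (∫ r in a..u, ‖L r‖) ^ k) volume a s :=
      hn.mul_continuousOn hcont
    calc ‖picardTerm L a v (k + 1) s‖
        ≤ ∫ u in a..s, ‖v‖ / (Nat.factorial k : ℝ) * (‖L u‖ * (∫ r in a..u, ‖L r‖) ^ k) := by
          refine intervalIntegral.norm_integral_le_of_norm_le hs
            (Filter.Eventually.of_forall fun u hu => ?_) (hint.const_mul _)
          refine ((L u).le_of_opNorm_le_of_le le_rfl (ih u hu.1.le)).trans (le_of_eq ?_)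
          ring
      _ = _ := by
          rw [intervalIntegral.integral_const_mul, integral_mul_pow_primitive hs hn]
          rw [Nat.factorial_succ]
          push_cast
          field_simp

theorem summable_picard_bound (c r : ℝ) :
    Summable fun k : ℕ => c * (r ^ k / (Nat.factorial k : ℝ)) :=
  (Real.summable_pow_div_factorial r).mul_left c

/-- A linear equation with locally integrable coefficient has a solution, in integrated form. -/
theorem exists_integral_solution [CompleteSpace E]
    (hL : ∀ a b, IntervalIntegrable L volume a b) (a : ℝ) (v : E) :
    ∃ x : ℝ → E, ContinuousOn x (Ici a) ∧ ∀ s, a ≤ s → x s = v + ∫ u in a..s, L u (x u) := by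
  have hmono : ∀ u s, a ≤ u → u ≤ s → ∫ r in a..u, ‖L r‖ ≤ ∫ r in a..s, ‖L r‖ := fun u s hau hus =>
    intervalIntegral.integral_mono_interval le_rfl hau hus
      (Filter.Eventually.of_forall fun r => norm_nonneg _) (hL a s).norm
  have hnn : ∀ u, a ≤ u → 0 ≤ ∫ r in a..u, ‖L r‖ := fun u hau =>
    intervalIntegral.integral_nonneg hau fun r _ => norm_nonneg _
  have hbd : ∀ k u s, a ≤ u → u ≤ s → ‖picardTerm L a v k u‖ ≤
      ‖v‖ * ((∫ r in a..s, ‖L r‖) ^ k / (Nat.factorial k : ℝ)) := by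
    intro k u s hau hus
    refine (norm_picardTerm_le hL a v k u hau).trans ?_
    have := hmono u s hau hus
    have := hnn u hau
    gcongr
  have hsum : ∀ u, a ≤ u → Summable fun k => picardTerm L a v k u := fun u hu =>
    Summable.of_norm_bounded (summable_picard_bound _ _) fun k => hbd k u u hu le_rfl
  refine ⟨fun s => ∑' k, picardTerm L a v k s, ?_, ?_⟩
  · intro s (hs : a ≤ s)
    -- The series converges uniformly on compact intervals; the endpoint `s + 1` leaves room to the
    -- right of `s`.
    have hc : ContinuousOn (fun s => ∑' k, picardTerm L a v k s) (Icc a (s + 1)) :=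
      continuousOn_tsum (fun k => (continuous_picardTerm hL a v k).continuousOn)
        (summable_picard_bound ‖v‖ (∫ r in a..(s + 1), ‖L r‖))
        fun k u hu => hbd k u (s + 1) hu.1 hu.2
    refine (hc s ⟨hs, by linarith⟩).mono_of_mem_nhdsWithin ?_
    rw [← Ici_inter_Iic]
    exact inter_mem_nhdsWithin _ (Iic_mem_nhds (by linarith))
  · intro s hs
    have hI : HasSum (fun k => ∫ u in a..s, L u (picardTerm L a v k u))
        (∫ u in a..s, L u (∑' k, picardTerm L a v k u)) := by
      refine intervalIntegral.hasSum_integral_of_dominated_convergence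
        (fun k u => ‖L u‖ * (‖v‖ * ((∫ r in a..s, ‖L r‖) ^ k / (Nat.factorial k : ℝ))))
        (fun k => ?_) (fun k => ?_) ?_ ?_ ?_
      · exact (intervalIntegrable_iff.1 ((hL a s).clm_apply_continuousOn
          (continuous_picardTerm hL a v k).continuousOn)).aestronglyMeasurable
      · refine Filter.Eventually.of_forall fun u hu => ?_
        rw [uIoc_of_le hs] at hu
        exact (L u).le_of_opNorm_le_of_le le_rfl (hbd k u s hu.1.le hu.2)
      · exact Filter.Eventually.of_forall fun u _ => (summable_picard_bound _ _).mul_left _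
      · simp_rw [tsum_mul_left]
        exact (hL a s).norm.mul_const _
      · refine Filter.Eventually.of_forall fun u hu => ?_
        rw [uIoc_of_le hs] at hu
        exact (L u).hasSum (hsum u hu.1.le).hasSum
    have h1 := (hsum s hs).tsum_eq_zero_add
    simp only [h1]
    congr 1
    exact hI.tsum_eq

end LinearODE


theorem IntervalIntegrable.sum_sum_smul_const {ι F : Type*} [Fintype ι] [NormedAddCommGroup F]
    [NormedSpace ℝ F] {W : ι → ι → ℝ → ℝ} {a b : ℝ}
    (hW : ∀ i j, IntervalIntegrable (W i j) volume a b) (B : ι → ι → F) :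
    IntervalIntegrable (fun u => ∑ i, ∑ j, W i j u • B i j) volume a b := by
  rw [intervalIntegrable_iff]
  refine integrable_finsetSum _ fun i _ => integrable_finsetSum _ fun j _ => ?_
  exact (intervalIntegrable_iff.1 (hW i j)).smul_const _

/-- Necessity tests agreement on solutions with prescribed initial values, so these have to exist.
-/
theorem exists_caratheodory_solution {ι : Type*} [Fintype ι] {W : ι → ι → ℝ → ℝ}
    (hW : ∀ i j a b, IntervalIntegrable (W i j) volume a b) (a : ℝ) (v : ι → ℝ) :
    ∃ x : ℝ → ι → ℝ, x a = v ∧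
      (∀ i T, a ≤ T → AbsolutelyContinuousOnInterval (fun t => x t i) a T) ∧
      ∀ᵐ t ∂(volume.restrict (Ici a)), ∀ i,
        HasDerivAt (fun s => x s i) (∑ j, W i j t * (x t j - x t i)) t := by
  classical
  set L : ℝ → (ι → ℝ) →L[ℝ] (ι → ℝ) := fun u => ∑ i, ∑ j, W i j u •
    (ContinuousLinearMap.single ℝ (fun _ : ι => ℝ) i).comp
      (ContinuousLinearMap.proj (R := ℝ) (φ := fun _ : ι => ℝ) j -
        ContinuousLinearMap.proj (R := ℝ) (φ := fun _ : ι => ℝ) i) with hLdef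
  have hLapp : ∀ u y i, L u y i = ∑ j, W i j u * (y j - y i) := by
    intro u y i
    simp only [hLdef, _root_.sum_apply, Finset.sum_apply, _root_.smul_apply,
      ContinuousLinearMap.comp_apply, Pi.smul_apply, ContinuousLinearMap.single_apply,
      _root_.sub_apply, ContinuousLinearMap.proj_apply, smul_eq_mul]
    rw [Finset.sum_eq_single i]
    · simp
    · intro k _ hk
      simp [Pi.single_eq_of_ne hk.symm]
    · simp
  have hL : ∀ c d, IntervalIntegrable L volume c d := by
    intro c d
    exact IntervalIntegrable.sum_sum_smul_const (fun i j => hW i j c d) _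
  obtain ⟨x, hxc, hx⟩ := exists_integral_solution hL a v
  have hint : ∀ T, a ≤ T → IntervalIntegrable (fun u => L u (x u)) volume a T := by
    intro T hT
    refine (hL a T).clm_apply_continuousOn (hxc.mono ?_)
    rw [uIcc_of_le hT]
    exact Icc_subset_Ici_self
  have hinti : ∀ i T, a ≤ T → IntervalIntegrable (fun u => L u (x u) i) volume a T := by
    intro i T hT
    have := hint T hT
    rw [intervalIntegrable_iff] at this ⊢
    exact (ContinuousLinearMap.proj (R := ℝ) (φ := fun _ : ι => ℝ) i).integrable_comp this
  have hxi : ∀ i s, a ≤ s → x s i = v i + ∫ u in a..s, L u (x u) i := by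
    intro i s hs
    have h1 := congrFun (hx s hs) i
    rw [h1, Pi.add_apply]
    congr 1
    exact ((ContinuousLinearMap.proj (R := ℝ) (φ := fun _ : ι => ℝ)
      i).intervalIntegral_comp_comm (hint s hs)).symm
  refine ⟨x, by simpa using hx a le_rfl, fun i T hT => ?_, ?_⟩
  · have h1 := (absolutelyContinuousOnInterval_const (v i) a T).fun_add
      ((hinti i T hT).absolutelyContinuousOnInterval_intervalIntegral (c := a) left_mem_uIcc)
    refine h1.congr_on ?_
    intro s hs
    rw [uIcc_of_le hT] at hs
    exact (hxi i s hs.1).symm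
  · rw [ae_restrict_iff' measurableSet_Ici]
    have hne : ∀ᵐ s : ℝ, s ≠ a := by simp [ae_iff, measure_singleton]
    -- Integer lengths `m` exhaust the half-line with only countably many null sets.
    have hall : ∀ᵐ s : ℝ, ∀ i, ∀ m : ℕ, s ∈ uIcc a (a + m) → ∀ c ∈ uIcc a (a + m),
        HasDerivAt (fun s => ∫ u in c..s, L u (x u) i) (L s (x s) i) s := by
      rw [ae_all_iff]
      intro i
      rw [ae_all_iff]
      intro m
      exact (hinti i (a + m) (by simp)).ae_hasDerivAt_integral
    filter_upwards [hall, hne] with s hs hsa hmem i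
    have has : a < s := lt_of_le_of_ne hmem (Ne.symm hsa)
    obtain ⟨m, hm⟩ := exists_nat_ge (s - a)
    have h1 := hs i m (by rw [uIcc_of_le (by simp)]; exact ⟨has.le, by linarith⟩) a left_mem_uIcc
    rw [← hLapp]
    refine (h1.const_add (v i)).congr_of_eventuallyEq ?_
    filter_upwards [lt_mem_nhds has] with r hr
    exact hxi i r hr.le

/-! ### The spread of a vector -/

theorem le_ciSup_fin {n : ℕ} (x : Fin n → ℝ) (i : Fin n) : x i ≤ ⨆ i, x i :=
  le_ciSup (Set.finite_range x).bddAbove i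

theorem ciInf_le_fin {n : ℕ} (x : Fin n → ℝ) (i : Fin n) : ⨅ i, x i ≤ x i :=
  ciInf_le (Set.finite_range x).bddBelow i

theorem sub_le_beliefSpread {n : ℕ} (x : Fin n → ℝ) (i j : Fin n) :
    x i - x j ≤ beliefSpread x :=
  sub_le_sub (le_ciSup_fin x i) (ciInf_le_fin x j)

theorem beliefSpread_le {n : ℕ} [Nonempty (Fin n)] {x : Fin n → ℝ} {m M : ℝ}
    (hm : ∀ i, m ≤ x i) (hM : ∀ i, x i ≤ M) : beliefSpread x ≤ M - m :=
  sub_le_sub (ciSup_le hM) (le_ciInf hm)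

theorem beliefSpread_nonneg {n : ℕ} [Nonempty (Fin n)] (x : Fin n → ℝ) : 0 ≤ beliefSpread x := by
  simpa using sub_le_beliefSpread x (Classical.arbitrary _) (Classical.arbitrary _)

theorem beliefSpread_of_subsingleton {n : ℕ} [Nonempty (Fin n)] [Subsingleton (Fin n)]
    (x : Fin n → ℝ) : beliefSpread x = 0 := by
  refine le_antisymm ?_ (beliefSpread_nonneg x)
  have i : Fin n := Classical.arbitrary _
  simpa using beliefSpread_le (x := x) (m := x i) (M := x i)
    (fun j => by rw [Subsingleton.elim i j]) (fun j => by rw [Subsingleton.elim i j])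

namespace SocialNetwork

variable {n : ℕ} {N : SocialNetwork n}

/-! ### The coefficient matrix -/

open Classical in
/-- The weights, extended by zero to the pairs that are not arcs and to negative times. -/
noncomputable def coupling (N : SocialNetwork n) (i j : Fin n) : ℝ → ℝ :=
  if N.graph.Adj j i then (Ici (0 : ℝ)).indicator (N.weight i j) else 0

theorem coupling_of_adj {i j : Fin n} (h : N.graph.Adj j i) {s : ℝ} (hs : 0 ≤ s) :
    N.coupling i j s = N.weight i j s := by
  simp [coupling, h, hs]

theorem coupling_of_not_adj {i j : Fin n} (h : ¬ N.graph.Adj j i) (s : ℝ) :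
    N.coupling i j s = 0 := by
  simp [coupling, h]

theorem coupling_self (i : Fin n) (s : ℝ) : N.coupling i i s = 0 :=
  coupling_of_not_adj (N.loopless i) s

theorem coupling_nonneg (N : SocialNetwork n) (i j : Fin n) (s : ℝ) : 0 ≤ N.coupling i j s := by
  by_cases h : N.graph.Adj j i
  · rw [coupling, if_pos h]
    exact indicator_nonneg (fun t ht => N.weight_nonneg i j h t ht) s
  · rw [coupling_of_not_adj h]

theorem intervalIntegrable_coupling (hint : N.LocallyIntegrableWeights) (i j : Fin n) (a b : ℝ) :
    IntervalIntegrable (N.coupling i j) volume a b := by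
  by_cases h : N.graph.Adj j i
  · rw [coupling, if_pos h, intervalIntegrable_iff]
    refine IntegrableOn.mono_set ?_ uIoc_subset_uIcc
    rw [integrableOn_indicator_iff measurableSet_Ici]
    exact (hint i j h).integrableOn_compact_subset inter_subset_left
      (isCompact_uIcc.inter_left isClosed_Ici)
  · rw [coupling, if_neg h]
    exact intervalIntegrable_const

theorem sum_neighbors_eq (i : Fin n) {s : ℝ} (hs : 0 ≤ s) (y : Fin n → ℝ) :
    ∑ j ∈ N.neighbors i, N.weight i j s * (y j - y i)
      = ∑ j, N.coupling i j s * (y j - y i) := by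
  classical
  rw [neighbors, Finset.sum_filter]
  refine Finset.sum_congr rfl fun j _ => ?_
  by_cases hji : j = i
  · subst hji
    simp
  · by_cases h : N.graph.Adj j i
    · simp [h, coupling_of_adj h hs]
    · simp [h, hji, coupling_of_not_adj h]

open Classical in
theorem theta_eq_sum (N : SocialNetwork n) {s : ℝ} (hs : 0 ≤ s) :
    N.theta s = ∑ i, ∑ j, if N.persistentGraph.Adj j i then 0 else N.coupling i j s := by
  rw [theta, Finset.sum_filter, Fintype.sum_prod_type, Finset.sum_comm]
  refine Finset.sum_congr rfl fun i _ => Finset.sum_congr rfl fun j _ => ?_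
  by_cases hp : N.persistentGraph.Adj j i
  · simp [hp]
  · by_cases h : N.graph.Adj j i
    · simp [h, hp, coupling_of_adj h hs]
    · simp [h, hp, coupling_of_not_adj h]

theorem theta_nonneg (N : SocialNetwork n) {s : ℝ} (hs : 0 ≤ s) : 0 ≤ N.theta s := by
  classical
  rw [theta_eq_sum N hs]
  refine Finset.sum_nonneg fun i _ => Finset.sum_nonneg fun j _ => ?_
  split_ifs
  · exact le_rfl
  · exact N.coupling_nonneg i j s

open Classical in
theorem sum_nonpersistent_le_theta (N : SocialNetwork n) (i : Fin n) {s : ℝ} (hs : 0 ≤ s) :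
    ∑ j, (if N.persistentGraph.Adj j i then 0 else N.coupling i j s) ≤ N.theta s := by
  rw [theta_eq_sum N hs]
  refine Finset.single_le_sum
    (f := fun i => ∑ j, if N.persistentGraph.Adj j i then 0 else N.coupling i j s)
    (fun k _ => Finset.sum_nonneg fun j _ => ?_) (Finset.mem_univ i)
  split_ifs
  · exact le_rfl
  · exact N.coupling_nonneg k j s

theorem intervalIntegrable_theta (hint : N.LocallyIntegrableWeights) {a b : ℝ} (ha : 0 ≤ a)
    (hb : 0 ≤ b) : IntervalIntegrable N.theta volume a b := by
  rw [intervalIntegrable_iff]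
  exact (N.integrableOn_theta hint).mono_set fun s hs => (le_min ha hb).trans_lt hs.1

theorem integral_theta_le {a b : ℝ} (hint : N.LocallyIntegrableWeights) (ha : 0 ≤ a) (hab : a ≤ b) :
    ∫ s in a..b, N.theta s ≤ ∫ s in Ioi a, N.theta s := by
  rw [intervalIntegral.integral_of_le hab]
  refine setIntegral_mono_set ((N.integrableOn_theta hint).mono_set (Ioi_subset_Ioi ha)) ?_
    (Filter.Eventually.of_forall fun s hs => hs.1)
  filter_upwards [ae_restrict_mem measurableSet_Ioi] with s hs
  exact N.theta_nonneg (ha.trans (le_of_lt hs))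

theorem setIntegral_Ioi_theta_le {a : ℝ} (hint : N.LocallyIntegrableWeights) (ha : 0 ≤ a) :
    ∫ s in Ioi a, N.theta s ≤ ∫ s in Ioi (0 : ℝ), N.theta s := by
  refine setIntegral_mono_set (N.integrableOn_theta hint) ?_
    (Filter.Eventually.of_forall fun s hs => lt_of_le_of_lt ha hs)
  filter_upwards [ae_restrict_mem measurableSet_Ioi] with s hs
  exact N.theta_nonneg (le_of_lt hs)

/-! ### Solutions -/

theorem exists_isSolution (hint : N.LocallyIntegrableWeights) {t₀ : ℝ} (ht₀ : 0 ≤ t₀)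
    (v : Fin n → ℝ) : ∃ x, N.IsSolution t₀ x ∧ x t₀ = v := by
  obtain ⟨x, hx0, hac, hd⟩ := exists_caratheodory_solution
    (fun i j a b => N.intervalIntegrable_coupling hint i j a b) t₀ v
  refine ⟨x, ⟨hac, ?_⟩, hx0⟩
  filter_upwards [hd, ae_restrict_mem measurableSet_Ici] with t ht hmem i
  rw [sum_neighbors_eq i (ht₀.trans hmem)]
  exact ht i

variable {t₀ : ℝ} {x : ℝ → Fin n → ℝ}

theorem IsSolution.restart (hx : N.IsSolution t₀ x) {t : ℝ} (ht : t₀ ≤ t) : N.IsSolution t x := by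
  refine ⟨fun i T hT => (hx.1 i T (ht.trans hT)).mono ?_, ?_⟩
  · rw [uIcc_of_le hT, uIcc_of_le (ht.trans hT)]
    exact Icc_subset_Icc_left ht
  · exact ae_restrict_of_ae_restrict_of_subset (Ici_subset_Ici.2 ht) hx.2

/-- The reflection that turns lower bounds for solutions into upper bounds. -/
theorem IsSolution.const_sub (hx : N.IsSolution t₀ x) (M : ℝ) :
    N.IsSolution t₀ fun s i => M - x s i := by
  refine ⟨fun i T hT => (absolutelyContinuousOnInterval_const M t₀ T).fun_sub (hx.1 i T hT), ?_⟩
  filter_upwards [hx.2] with t ht i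
  refine ((ht i).const_sub M).congr_deriv ?_
  rw [← Finset.sum_neg_distrib]
  exact Finset.sum_congr rfl fun j _ => by ring

theorem IsSolution.const_add (hx : N.IsSolution t₀ x) (M : ℝ) :
    N.IsSolution t₀ fun s i => M + x s i := by
  refine ⟨fun i T hT => (absolutelyContinuousOnInterval_const M t₀ T).fun_add (hx.1 i T hT), ?_⟩
  filter_upwards [hx.2] with t ht i
  refine ((ht i).const_add M).congr_deriv ?_
  exact Finset.sum_congr rfl fun j _ => by ring

/-- The equation is linear, so `x - v` satisfies the cooperative inequality and stays nonnegative.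
-/
theorem IsSolution.subsolution_le (hint : N.LocallyIntegrableWeights) (hx : N.IsSolution t₀ x)
    (ht₀ : 0 ≤ t₀) {T : ℝ} (hT : t₀ ≤ T) {v v' : Fin n → ℝ → ℝ}
    (hv : ∀ i, AbsolutelyContinuousOnInterval (v i) t₀ T)
    (hv' : ∀ i, ∀ᵐ s, s ∈ Ioc t₀ T → HasDerivAt (v i) (v' i s) s ∧
      v' i s ≤ ∑ j, N.coupling i j s * (v j s - v i s))
    (h0 : ∀ i, v i t₀ ≤ x t₀ i) : ∀ s ∈ Icc t₀ T, ∀ i, v i s ≤ x s i := by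
  intro s hs i
  refine sub_nonneg.1 (cooperative_nonneg_of_initial_nonneg (z := fun i s => x s i - v i s)
    (z' := fun i s => ∑ j, N.coupling i j s * (x s j - x s i) - v' i s) hT
    (fun i j s _ => N.coupling_nonneg i j s)
    (fun i j => N.intervalIntegrable_coupling hint i j _ _)
    (fun i => (hx.1 i T hT).fun_sub (hv i)) (fun i => ?_)
    (fun i => sub_nonneg.2 (h0 i)) s hs i)
  have hd := (ae_restrict_iff' measurableSet_Ici).1 hx.2
  filter_upwards [hd, hv' i] with u hu hvu hmem
  have hu' := hu hmem.1.le i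
  rw [sum_neighbors_eq i (ht₀.trans hmem.1.le)] at hu'
  refine ⟨hu'.sub (hvu hmem).1, ?_⟩
  have : ∑ j, N.coupling i j u * (x u j - v j u - (x u i - v i u))
      = ∑ j, N.coupling i j u * (x u j - x u i) - ∑ j, N.coupling i j u * (v j u - v i u) := by
    rw [← Finset.sum_sub_distrib]
    exact Finset.sum_congr rfl fun j _ => by ring
  rw [this]
  linarith [(hvu hmem).2]

theorem IsSolution.le_of_le_initial (hint : N.LocallyIntegrableWeights) (hx : N.IsSolution t₀ x)
    (ht₀ : 0 ≤ t₀) {m : ℝ} (hm : ∀ i, m ≤ x t₀ i) {s : ℝ} (hs : t₀ ≤ s) (i : Fin n) :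
    m ≤ x s i :=
  hx.subsolution_le hint ht₀ hs (v := fun _ _ => m) (v' := fun _ _ => 0)
    (fun _ => absolutelyContinuousOnInterval_const _ _ _)
    (fun i => Filter.Eventually.of_forall fun s _ => ⟨hasDerivAt_const _ _, by simp⟩)
    hm s ⟨hs, le_rfl⟩ i

theorem IsSolution.le_of_initial_le (hint : N.LocallyIntegrableWeights) (hx : N.IsSolution t₀ x)
    (ht₀ : 0 ≤ t₀) {M : ℝ} (hM : ∀ i, x t₀ i ≤ M) {s : ℝ} (hs : t₀ ≤ s) (i : Fin n) :
    x s i ≤ M := by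
  have := (hx.const_sub M).le_of_le_initial hint ht₀ (m := 0) (fun i => sub_nonneg.2 (hM i)) hs i
  linarith

open Classical in
/-- A set of nodes keeps its values up to the exponential of the total inflow from outside. -/
theorem IsSolution.exp_neg_inflow_le (hint : N.LocallyIntegrableWeights)
    (hx : N.IsSolution t₀ x) (ht₀ : 0 ≤ t₀) {T : ℝ} (hT : t₀ ≤ T) (S : Set (Fin n)) {g : ℝ → ℝ}
    (hg : IntervalIntegrable g volume t₀ T)
    (hin : ∀ s ∈ Ioc t₀ T, ∀ i ∈ S, ∑ j, (if j ∈ S then 0 else N.coupling i j s) ≤ g s)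
    (h0 : ∀ i, 0 ≤ x t₀ i) (h1 : ∀ i ∈ S, 1 ≤ x t₀ i) :
    ∀ i ∈ S, Real.exp (-∫ s in t₀..T, g s) ≤ x T i := by
  intro i hi
  have hac : AbsolutelyContinuousOnInterval (fun s => Real.exp (-∫ u in t₀..s, g u)) t₀ T :=
    Real.contDiff_exp.comp_absolutelyContinuousOnInterval
      (hg.absolutelyContinuousOnInterval_intervalIntegral left_mem_uIcc).fun_neg
  -- The subsolution is `exp (-∫ g)` on `S` and 0 elsewhere. Arcs inside `S` join equal values and
  -- contribute nothing; arcs from outside cost at most `g` times the common value.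
  have key := hx.subsolution_le hint ht₀ hT
    (v := fun i s => if i ∈ S then Real.exp (-∫ u in t₀..s, g u) else 0)
    (v' := fun i s => if i ∈ S then Real.exp (-∫ u in t₀..s, g u) * (-g s) else 0)
    (fun k => ?_) (fun k => ?_) (fun k => ?_) T ⟨hT, le_rfl⟩ i
  · simpa [hi] using key
  · by_cases hk : k ∈ S
    · simpa [hk] using hac
    · simpa [hk] using absolutelyContinuousOnInterval_const _ _ _
  · by_cases hk : k ∈ S
    · filter_upwards [hg.ae_hasDerivAt_integral] with s hs hmem
      have hsI : s ∈ uIcc t₀ T := by rw [uIcc_of_le hT]; exact ⟨hmem.1.le, hmem.2⟩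
      simp only [hk, if_true]
      refine ⟨(hs hsI t₀ left_mem_uIcc).neg.exp, ?_⟩
      set e := Real.exp (-∫ u in t₀..s, g u)
      have he : 0 < e := Real.exp_pos _
      have : ∑ j, N.coupling k j s * ((if j ∈ S then e else 0) - e)
          = -(e * ∑ j, (if j ∈ S then 0 else N.coupling k j s)) := by
        rw [Finset.mul_sum, ← Finset.sum_neg_distrib]
        refine Finset.sum_congr rfl fun j _ => ?_
        split_ifs <;> ring
      rw [this]
      nlinarith [hin s hmem k hk]
    · refine Filter.Eventually.of_forall fun s _ => ?_
      simp only [hk, if_false]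
      refine ⟨hasDerivAt_const _ _, Finset.sum_nonneg fun j _ => ?_⟩
      refine mul_nonneg (N.coupling_nonneg k j s) ?_
      split_ifs <;> simp [Real.exp_nonneg]
  · by_cases hk : k ∈ S
    · simpa [hk] using h1 k hk
    · simpa [hk] using h0 k

end SocialNetwork

/-! ### Walks -/

namespace Digraph

variable {V : Type*} {G : Digraph V}

theorem hasWalk_zero (i : V) : G.HasWalk 0 i i := ⟨fun _ => i, rfl, rfl, by simp⟩

theorem HasWalk.eq_of_zero {i j : V} (h : G.HasWalk 0 i j) : i = j := by
  obtain ⟨p, h0, hk, -⟩ := h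
  exact h0.symm.trans hk

theorem HasWalk.snoc {k : ℕ} {i j l : V} (h : G.HasWalk k i j) (hjl : G.Adj j l) :
    G.HasWalk (k + 1) i l := by
  classical
  obtain ⟨p, h0, hk, hp⟩ := h
  refine ⟨fun m => if m ≤ k then p m else l, by simp [h0], by simp, fun m hm => ?_⟩
  rcases (Nat.lt_succ_iff.1 hm).lt_or_eq with hlt | rfl
  · have h1 : m + 1 ≤ k := hlt
    simpa [hlt.le, h1] using hp m hlt
  · simpa [hk] using hjl

theorem HasWalk.exists_snoc {k : ℕ} {i l : V} (h : G.HasWalk (k + 1) i l) :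
    ∃ j, G.HasWalk k i j ∧ G.Adj j l := by
  obtain ⟨p, h0, hk, hp⟩ := h
  refine ⟨p k, ⟨p, h0, rfl, fun m hm => hp m (hm.trans (Nat.lt_succ_self k))⟩, ?_⟩
  rw [← hk]
  exact hp k (Nat.lt_succ_self k)

theorem Reachable.refl (i : V) : G.Reachable i i := ⟨0, hasWalk_zero i⟩

theorem Reachable.snoc {i j l : V} (h : G.Reachable i j) (hjl : G.Adj j l) : G.Reachable i l := by
  obtain ⟨k, hk⟩ := h
  exact ⟨k + 1, hk.snoc hjl⟩

theorem Reachable.trans {i j l : V} (h : G.Reachable i j) (h' : G.Reachable j l) :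
    G.Reachable i l := by
  obtain ⟨k, hk⟩ := h'
  induction k generalizing l with
  | zero => rwa [← hk.eq_of_zero]
  | succ k ih =>
    obtain ⟨m, hm, hml⟩ := hk.exists_snoc
    exact (ih hm).snoc hml

/-- A finite digraph without a center has two disjoint nonempty sets of nodes that no arc enters. -/
theorem exists_disjoint_closed_of_not_quasiStronglyConnected [Finite V] [Nonempty V]
    (h : ¬ G.QuasiStronglyConnected) :
    ∃ S T : Set V, S.Nonempty ∧ T.Nonempty ∧ Disjoint S T ∧
      (∀ i ∈ S, ∀ j, G.Adj j i → j ∈ S) ∧ (∀ i ∈ T, ∀ j, G.Adj j i → j ∈ T) := by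
  have hcl : ∀ c i, i ∈ {k | G.Reachable k c} → ∀ j, G.Adj j i → j ∈ {k | G.Reachable k c} :=
    fun c i hi j hji => ((Reachable.refl j).snoc hji).trans hi
  -- Take `c` with the fewest ancestors and `j` not reachable from `c`. A common ancestor `k` of `c`
  -- and `j` would, by minimality, have the same ancestors as `c`; then `c` would reach `k` and so
  -- `j`.
  obtain ⟨c, hc⟩ := Finite.exists_min fun c => {k | G.Reachable k c}.ncard
  simp only [QuasiStronglyConnected, not_exists, not_forall] at h
  obtain ⟨j, hj⟩ := h c
  refine ⟨{k | G.Reachable k c}, {k | G.Reachable k j}, ⟨c, Reachable.refl c⟩,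
    ⟨j, Reachable.refl j⟩, ?_, hcl c, hcl j⟩
  rw [Set.disjoint_left]
  intro k hkc hkj
  have hsub : {m | G.Reachable m k} ⊆ {m | G.Reachable m c} := fun m hm => Reachable.trans hm hkc
  have heq := Set.eq_of_subset_of_ncard_le hsub (hc k) (Set.toFinite _)
  have hck : G.Reachable c k := by
    have : c ∈ {m | G.Reachable m c} := Reachable.refl c
    rwa [← heq] at this
  exact hj (hck.trans hkj)

end Digraph

/-! ### Necessity of (a) and (b) -/

namespace SocialNetwork

variable {n : ℕ} {N : SocialNetwork n}

theorem exists_tail_integral_theta_le (hint : N.LocallyIntegrableWeights) {δ : ℝ} (hδ : 0 < δ) :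
    ∃ t, 0 ≤ t ∧ ∀ a b, t ≤ a → a ≤ b → ∫ s in a..b, N.theta s ≤ δ := by
  have hI := N.integrableOn_theta hint
  have ht := intervalIntegral_tendsto_integral_Ioi 0 hI Filter.tendsto_id
  have hev := (ht.eventually (lt_mem_nhds (sub_lt_self _ hδ))).and (Filter.eventually_ge_atTop 0)
  obtain ⟨t, ht1, ht2⟩ := hev.exists
  refine ⟨t, ht2, fun a b hta hab => ?_⟩
  simp only [id] at ht1
  have h0 : (0 : ℝ) ≤ a := ht2.trans hta
  have h1 : ∫ s in (0 : ℝ)..b, N.theta s ≤ ∫ s in Ioi (0 : ℝ), N.theta s :=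
    integral_theta_le hint le_rfl (h0.trans hab)
  have h2 := intervalIntegral.integral_add_adjacent_intervals
    (N.intervalIntegrable_theta hint le_rfl h0)
    (N.intervalIntegrable_theta hint h0 (h0.trans hab))
  have h3 := intervalIntegral.integral_add_adjacent_intervals
    (N.intervalIntegrable_theta hint le_rfl ht2)
    (N.intervalIntegrable_theta hint ht2 h0)
  have h4 : 0 ≤ ∫ s in t..a, N.theta s :=
    intervalIntegral.integral_nonneg hta fun s hs => N.theta_nonneg (ht2.trans hs.1)
  linarith

theorem integral_weight_eq {i j : Fin n} (h : N.graph.Adj j i) {a b : ℝ} (ha : 0 ≤ a)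
    (hab : a ≤ b) : ∫ s in a..b, N.weight i j s = ∫ s in a..b, N.coupling i j s := by
  refine intervalIntegral.integral_congr fun s hs => ?_
  rw [uIcc_of_le hab] at hs
  exact (coupling_of_adj h (ha.trans hs.1)).symm

open Classical in
/-- Two disjoint sets of nodes with small inflow from outside can be kept apart. -/
theorem exists_separated_solution (hint : N.LocallyIntegrableWeights) {t T : ℝ}
    (ht : 0 ≤ t) (hT : t ≤ T) {S₁ S₂ : Set (Fin n)} (h₁ : S₁.Nonempty) (h₂ : S₂.Nonempty)
    (hd : Disjoint S₁ S₂) {g : ℝ → ℝ} (hg : IntervalIntegrable g volume t T)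
    (hin₁ : ∀ s ∈ Ioc t T, ∀ i ∈ S₁, ∑ j, (if j ∈ S₁ then 0 else N.coupling i j s) ≤ g s)
    (hin₂ : ∀ s ∈ Ioc t T, ∀ i ∈ S₂, ∑ j, (if j ∈ S₂ then 0 else N.coupling i j s) ≤ g s) :
    ∃ x, N.IsSolution t x ∧ beliefSpread (x t) ≤ 1 ∧
      1 - 2 * ∫ s in t..T, g s ≤ beliefSpread (x T) := by
  obtain ⟨x, hx, hxt⟩ := N.exists_isSolution hint ht fun i => if i ∈ S₁ then (1 : ℝ) else 0
  obtain ⟨p, hp⟩ := h₁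
  obtain ⟨q, hq⟩ := h₂
  have : Nonempty (Fin n) := ⟨p⟩
  have hx0 : ∀ i, 0 ≤ x t i := fun i => by rw [hxt]; dsimp only; split_ifs <;> norm_num
  have hx1 : ∀ i, x t i ≤ 1 := fun i => by rw [hxt]; dsimp only; split_ifs <;> norm_num
  refine ⟨x, hx, by simpa using beliefSpread_le hx0 hx1, ?_⟩
  have hp' := hx.exp_neg_inflow_le hint ht hT S₁ hg hin₁ hx0 (fun i hi => by simp [hxt, hi]) p hp
  have hq' := (hx.const_sub 1).exp_neg_inflow_le hint ht hT S₂ hg hin₂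
    (fun i => sub_nonneg.2 (hx1 i))
    (fun i hi => by simp [hxt, Set.disjoint_right.1 hd hi]) q hq
  have hsp := sub_le_beliefSpread (x T) p q
  -- The two bounds give spread at least `2 exp (-∫ g) - 1`, and `exp (-u) ≥ 1 - u`.
  have hexp := Real.add_one_le_exp (-∫ s in t..T, g s)
  linarith

theorem quasiStronglyConnected_of_agreement (hn : 1 ≤ n) (hint : N.LocallyIntegrableWeights)
    (h : N.GlobalEpsAgreement) : N.persistentGraph.QuasiStronglyConnected := by
  classical
  have : Nonempty (Fin n) := ⟨⟨0, hn⟩⟩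
  by_contra hcon
  obtain ⟨S₁, S₂, h₁, h₂, hd, hc₁, hc₂⟩ :=
    Digraph.exists_disjoint_closed_of_not_quasiStronglyConnected hcon
  obtain ⟨ε, T₀, hε0, hε1, hT₀, hag⟩ := h
  -- With tail `1 / 4` the spread remains at least `1 / 2`, while `k` rounds of agreement would
  -- bring it to `ε ^ k < 1 / 2`.
  obtain ⟨t, ht, htail⟩ := exists_tail_integral_theta_le hint (δ := 1 / 4) (by norm_num)
  obtain ⟨k, hk⟩ := exists_pow_lt_of_lt_one (show (0 : ℝ) < 1 / 2 by norm_num) hε1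
  have hT : t ≤ t + k * T₀ := by
    have : 0 ≤ (k : ℝ) * T₀ := by positivity
    linarith
  have hin : ∀ S : Set (Fin n), (∀ i ∈ S, ∀ j, N.persistentGraph.Adj j i → j ∈ S) →
      ∀ s ∈ Ioc t (t + k * T₀), ∀ i ∈ S,
        ∑ j, (if j ∈ S then 0 else N.coupling i j s) ≤ N.theta s := by
    intro S hS s hs i hi
    refine (Finset.sum_le_sum fun j _ => ?_).trans
      (N.sum_nonpersistent_le_theta i (ht.trans hs.1.le))
    by_cases hj : j ∈ S
    · simp only [hj, if_true]
      split_ifs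
      · exact le_rfl
      · exact N.coupling_nonneg i j s
    · have : ¬ N.persistentGraph.Adj j i := fun hji => hj (hS i hi j hji)
      simp [hj, this]
  obtain ⟨x, hx, hx1, hxT⟩ := exists_separated_solution hint ht hT h₁ h₂ hd
    (N.intervalIntegrable_theta hint ht (ht.trans hT)) (hin S₁ hc₁) (hin S₂ hc₂)
  have hiter : ∀ m : ℕ, beliefSpread (x (t + m * T₀)) ≤ ε ^ m := by
    intro m
    induction m with
    | zero => simpa using hx1
    | succ m ih =>
      have h1 := hag t ht x hx (t + m * T₀) (by
        have : 0 ≤ (m : ℝ) * T₀ := by positivity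
        linarith)
      have h2 : t + ((m + 1 : ℕ) : ℝ) * T₀ = t + m * T₀ + T₀ := by push_cast; ring
      rw [h2, pow_succ']
      exact h1.trans (mul_le_mul_of_nonneg_left ih hε0.le)
  have := hiter k
  have := htail t _ le_rfl hT
  linarith

theorem uniformlyPersistent_of_agreement {A : ℝ} (hA : 1 < A) (hn : 1 ≤ n)
    (hbal : N.ArcBalance A) (hint : N.LocallyIntegrableWeights) (h : N.GlobalEpsAgreement) :
    ∃ a τ₀ : ℝ, 0 < a ∧ 0 < τ₀ ∧ N.UniformlyPersistent a τ₀ := by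
  classical
  obtain ⟨ε, T₀, hε0, hε1, hT₀, hag⟩ := h
  have hn' : (0 : ℝ) < n := by exact_mod_cast hn
  have hA0 : 0 < A := by linarith
  -- Persistent and non-persistent arcs will each contribute at most `η / 2` to the inflow, leaving
  -- spread at least `1 - 2 η = (1 + ε) / 2 > ε`.
  set η := (1 - ε) / 4 with hη
  have hη0 : 0 < η := by rw [hη]; linarith
  obtain ⟨r, hr, htail⟩ := exists_tail_integral_theta_le hint (δ := η / 2) (by linarith)
  -- The length `r + T₀` lets the test interval of length `T₀` start at `t + r`, where the tail of
  -- `θ` is already small. The bound on the weight is `η / 2` divided by the factor `n A` of `hin`.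
  refine ⟨η / (2 * n * A), r + T₀, by positivity, by linarith, fun i j hij t ht => ?_⟩
  by_contra hlt
  rw [not_le, integral_weight_eq hij.1 ht (by linarith)] at hlt
  set b := t + r with hb
  have hb0 : 0 ≤ b := by linarith
  have hbT : b ≤ b + T₀ := by linarith
  have hW : ∫ s in b..(b + T₀), N.coupling i j s ≤ η / (2 * n * A) := by
    refine le_trans ?_ hlt.le
    have : t + (r + T₀) = b + T₀ := by rw [hb]; ring
    rw [this]
    exact intervalIntegral.integral_mono_interval (by linarith) hbT le_rfl
      (Filter.Eventually.of_forall fun s => N.coupling_nonneg i j s)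
      (N.intervalIntegrable_coupling hint i j _ _)
  have hne : i ≠ j := by
    rintro rfl
    exact N.loopless i hij.1
  have hin : ∀ k, ∀ s ∈ Ioc b (b + T₀), ∀ i' ∈ ({k} : Set (Fin n)),
      ∑ l, (if l ∈ ({k} : Set (Fin n)) then 0 else N.coupling i' l s)
        ≤ N.theta s + n * A * N.coupling i j s := by
    rintro k s hs k' (rfl : k' = k)
    have hs0 : 0 ≤ s := hb0.trans hs.1.le
    have hWs := N.coupling_nonneg i j s
    -- By arc balance each persistent arc weighs at most `A` times the single weak arc `(j, i)`.
    calc ∑ l, (if l ∈ ({k'} : Set (Fin n)) then 0 else N.coupling k' l s)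
        ≤ ∑ l, ((if N.persistentGraph.Adj l k' then 0 else N.coupling k' l s)
            + A * N.coupling i j s) := by
          refine Finset.sum_le_sum fun l _ => ?_
          have h1 := N.coupling_nonneg k' l s
          have h2 : 0 ≤ A * N.coupling i j s := by positivity
          by_cases hp : N.persistentGraph.Adj l k'
          · have := (hbal i j k' l hij hp s hs0).2
            rw [← coupling_of_adj hij.1 hs0, ← coupling_of_adj hp.1 hs0] at this
            split_ifs <;> linarith
          · split_ifs <;> linarith
      _ = ∑ l, (if N.persistentGraph.Adj l k' then 0 else N.coupling k' l s)
            + n * A * N.coupling i j s := by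
          rw [Finset.sum_add_distrib]
          simp [mul_assoc]
      _ ≤ _ := by linarith [N.sum_nonpersistent_le_theta k' hs0]
  have hθi := N.intervalIntegrable_theta hint hb0 (hb0.trans hbT)
  have hci := (N.intervalIntegrable_coupling hint i j b (b + T₀)).const_mul (n * A)
  obtain ⟨x, hx, hx1, hxT⟩ := exists_separated_solution hint hb0 hbT
    (singleton_nonempty i) (singleton_nonempty j) (disjoint_singleton.2 hne)
    (hθi.add hci) (by convert hin i) (by convert hin j)
  have h1 := hag b hb0 x hx b le_rfl
  have h2 : ε * beliefSpread (x b) ≤ ε := by nlinarith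
  have h3 := htail b (b + T₀) (by linarith) hbT
  have h4 : ∫ s in b..(b + T₀), (N.theta s + n * A * N.coupling i j s)
      = (∫ s in b..(b + T₀), N.theta s) + n * A * ∫ s in b..(b + T₀), N.coupling i j s := by
    rw [intervalIntegral.integral_add hθi hci, intervalIntegral.integral_const_mul]
  have h5 : n * A * ∫ s in b..(b + T₀), N.coupling i j s ≤ η / 2 := by
    calc n * A * ∫ s in b..(b + T₀), N.coupling i j s
        ≤ n * A * (η / (2 * n * A)) := by gcongr
      _ = η / 2 := by field_simp
  have h6 : 1 - 2 * ((∫ s in b..(b + T₀), N.theta s)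
      + n * A * ∫ s in b..(b + T₀), N.coupling i j s) ≤ beliefSpread (x (b + T₀)) := h4 ▸ hxT
  rw [hη] at h3 h5
  linarith

end SocialNetwork

/-! ### The comparison chain -/

/-- `s ^ k / k! * exp (-r s)`. -/
noncomputable def poissonTerm (r : ℝ) (k : ℕ) (s : ℝ) : ℝ :=
  s ^ k / (Nat.factorial k : ℝ) * Real.exp (-(r * s))

/-- The inflow `poissonTerm r (k - 1)` into the `k`-th state of the chain, zero for `k = 0`. -/
noncomputable def poissonInflow (r : ℝ) : ℕ → ℝ → ℝ
  | 0 => 0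
  | k + 1 => poissonTerm r k

/-- The mass `r⁻ᵏ P(Γ(k) ≤ r s)` absorbed in the `k`-th state, for `Γ(k)` Gamma distributed. -/
noncomputable def absorbedMass (r : ℝ) : ℕ → ℝ → ℝ
  | 0 => fun _ => 1
  | k + 1 => fun s => (absorbedMass r k s - poissonTerm r k s) / r

theorem poissonTerm_nonneg (r : ℝ) (k : ℕ) {s : ℝ} (hs : 0 ≤ s) : 0 ≤ poissonTerm r k s := by
  unfold poissonTerm
  positivity

theorem poissonInflow_nonneg (r : ℝ) (k : ℕ) {s : ℝ} (hs : 0 ≤ s) : 0 ≤ poissonInflow r k s := by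
  cases k with
  | zero => simp [poissonInflow]
  | succ k => exact poissonTerm_nonneg r k hs

theorem poissonTerm_zero_right (r : ℝ) (k : ℕ) : poissonTerm r k 0 = if k = 0 then 1 else 0 := by
  cases k <;> simp [poissonTerm]

theorem contDiff_poissonTerm (r : ℝ) (k : ℕ) : ContDiff ℝ 1 (poissonTerm r k) :=
  ((contDiff_id.pow k).div_const _).mul (contDiff_const.mul contDiff_id).neg.exp

theorem hasDerivAt_poissonTerm (r : ℝ) (k : ℕ) (s : ℝ) :
    HasDerivAt (poissonTerm r k) (poissonInflow r k s - r * poissonTerm r k s) s := by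
  have he : HasDerivAt (fun s => Real.exp (-(r * s))) (Real.exp (-(r * s)) * -(r * 1)) s :=
    ((hasDerivAt_id s).const_mul r).neg.exp
  have hp := ((hasDerivAt_pow k s).div_const (Nat.factorial k : ℝ)).mul he
  refine hp.congr_deriv ?_
  cases k with
  | zero => simp [poissonInflow, poissonTerm]; ring
  | succ k =>
    simp only [poissonInflow, poissonTerm, Nat.factorial_succ, Nat.add_sub_cancel]
    have : (Nat.factorial k : ℝ) ≠ 0 := by positivity
    have : (k : ℝ) + 1 ≠ 0 := by positivity
    push_cast
    field_simp
    ring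

theorem contDiff_absorbedMass (r : ℝ) (k : ℕ) : ContDiff ℝ 1 (absorbedMass r k) := by
  induction k with
  | zero => exact contDiff_const
  | succ k ih => exact (ih.sub (contDiff_poissonTerm r k)).div_const r

theorem absorbedMass_zero_right (r : ℝ) (k : ℕ) : absorbedMass r k 0 = if k = 0 then 1 else 0 := by
  induction k with
  | zero => simp [absorbedMass]
  | succ k ih => simp [absorbedMass, ih, poissonTerm_zero_right]

/-- The recursion for the mass is integration by parts; differentiating it cancels the inflow into
state `k` and leaves `poissonTerm r k`. -/
theorem hasDerivAt_absorbedMass {r : ℝ} (hr : 0 < r) (k : ℕ) (s : ℝ) :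
    HasDerivAt (absorbedMass r k) (poissonInflow r k s) s := by
  induction k with
  | zero => exact hasDerivAt_const _ _
  | succ k ih =>
    refine ((ih.sub (hasDerivAt_poissonTerm r k s)).div_const r).congr_deriv ?_
    simp only [poissonInflow]
    field_simp
    ring

theorem absorbedMass_nonneg {r : ℝ} (hr : 0 < r) (k : ℕ) {s : ℝ} (hs : 0 ≤ s) :
    0 ≤ absorbedMass r k s := by
  have hmono : MonotoneOn (absorbedMass r k) (Ici 0) := by
    refine monotoneOn_of_deriv_nonneg (convex_Ici 0)
      (contDiff_absorbedMass r k).continuous.continuousOn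
      (fun u _ => (hasDerivAt_absorbedMass hr k u).differentiableAt.differentiableWithinAt)
      fun u hu => ?_
    rw [interior_Ici] at hu
    rw [(hasDerivAt_absorbedMass hr k u).deriv]
    exact poissonInflow_nonneg r k (le_of_lt hu)
  refine le_trans ?_ (hmono (mem_Ici.2 le_rfl) hs hs)
  rw [absorbedMass_zero_right]
  split_ifs <;> norm_num

/-- A standard exponential variable has median `log 2`, so a sum of `k` independent ones is at most
`k log 2` with probability at least `2⁻ᵏ`. The induction expresses this through the equation `m' =
absorbedMass r k - r m` for `m = absorbedMass r (k + 1)`. -/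
theorem le_absorbedMass {r : ℝ} (hr : 0 < r) (k : ℕ) {s : ℝ} (hs : k * Real.log 2 ≤ r * s) :
    (1 / (2 * r)) ^ k ≤ absorbedMass r k s := by
  induction k generalizing s with
  | zero => simp [absorbedMass]
  | succ k ih =>
    set q := (1 / (2 * r)) ^ k with hq
    have hq0 : 0 < q := by positivity
    have hlog : 0 < Real.log 2 := Real.log_pos one_lt_two
    set s₁ := k * Real.log 2 / r with hs₁
    have hrs₁ : r * s₁ = k * Real.log 2 := by rw [hs₁]; field_simp
    have hs₁0 : 0 ≤ s₁ := by positivity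
    push_cast at hs
    have hgap : Real.log 2 ≤ r * s - r * s₁ := by rw [hrs₁]; linarith
    have hs₁s : s₁ ≤ s := by
      by_contra hlt
      have := mul_lt_mul_of_pos_left (not_le.1 hlt) hr
      linarith
    -- After `s₁` the source term is at least `q`, so `F` increases; the remaining time, at least
    -- `log 2 / r`, brings `m` from a nonnegative value to at least half of the equilibrium `q / r`.
    set F : ℝ → ℝ := fun u => Real.exp (r * u) * (absorbedMass r (k + 1) u - q / r) with hF
    have hFd : ∀ u, HasDerivAt F (Real.exp (r * u) * (absorbedMass r k u - q)) u := by
      intro u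
      have he : HasDerivAt (fun u => Real.exp (r * u)) (Real.exp (r * u) * (r * 1)) u :=
        ((hasDerivAt_id u).const_mul r).exp
      refine (he.mul ((hasDerivAt_absorbedMass hr (k + 1) u).sub_const (q / r))).congr_deriv ?_
      simp only [poissonInflow, absorbedMass]
      field_simp
      ring
    have hmono : MonotoneOn F (Icc s₁ s) := by
      refine monotoneOn_of_deriv_nonneg (convex_Icc _ _)
        (fun u _ => (hFd u).continuousAt.continuousWithinAt)
        (fun u _ => (hFd u).differentiableAt.differentiableWithinAt) fun u hu => ?_
      rw [interior_Icc] at hu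
      rw [(hFd u).deriv]
      refine mul_nonneg (Real.exp_pos _).le (sub_nonneg.2 (ih ?_))
      rw [← hrs₁]
      exact mul_le_mul_of_nonneg_left hu.1.le hr.le
    have h1 := hmono (left_mem_Icc.2 hs₁s) (right_mem_Icc.2 hs₁s) hs₁s
    simp only [hF] at h1
    have h2 := absorbedMass_nonneg hr (k + 1) hs₁0
    have h3 : 2 * Real.exp (r * s₁) ≤ Real.exp (r * s) := by
      have : Real.exp (Real.log 2 + r * s₁) ≤ Real.exp (r * s) := Real.exp_le_exp.2 (by linarith)
      rwa [Real.exp_add, Real.exp_log two_pos] at this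
    have h4 : (1 / (2 * r)) ^ (k + 1) = q / r / 2 := by
      rw [pow_succ, ← hq]
      field_simp
    rw [h4]
    have hqr : 0 < q / r := by positivity
    set m := absorbedMass r (k + 1) s
    set m₁ := absorbedMass r (k + 1) s₁
    have h5 : Real.exp (r * s₁) * -(q / r) ≤ Real.exp (r * s) * (m - q / r) :=
      le_trans (mul_le_mul_of_nonneg_left (by linarith) (Real.exp_pos _).le) h1
    have h6 : 0 < Real.exp (r * s) := Real.exp_pos _
    by_contra hlt
    nlinarith [mul_le_mul_of_nonneg_right h3 hqr.le]

/-- The mass in the states `l, …, d - 1` of the chain with `d` transient states. -/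
noncomputable def transientMass (r : ℝ) (d l : ℕ) (s : ℝ) : ℝ :=
  ∑ k ∈ Finset.Ico l d, poissonTerm r k s

theorem transientMass_nonneg (r : ℝ) (d l : ℕ) {s : ℝ} (hs : 0 ≤ s) : 0 ≤ transientMass r d l s :=
  Finset.sum_nonneg fun k _ => poissonTerm_nonneg r k hs

theorem transientMass_eq_add (r : ℝ) {d l : ℕ} (hl : l < d) (s : ℝ) :
    transientMass r d l s = poissonTerm r l s + transientMass r d (l + 1) s :=
  Finset.sum_eq_sum_Ico_succ_bot hl _

/-- The mass in the states from `l` on. -/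
noncomputable def upperMass (r : ℝ) (d l : ℕ) (s : ℝ) : ℝ :=
  transientMass r d l s + absorbedMass r d s

theorem upperMass_zero_right (r : ℝ) {d l : ℕ} (hd : d ≠ 0) :
    upperMass r d l 0 = if l = 0 then 1 else 0 := by
  simp only [upperMass, transientMass, absorbedMass_zero_right, hd, if_false, add_zero,
    poissonTerm_zero_right]
  rw [Finset.sum_ite_eq' (Finset.Ico l d) 0 fun _ => (1 : ℝ)]
  have : 0 ∈ Finset.Ico l d ↔ l = 0 := by
    rw [Finset.mem_Ico]
    omega
  simp [this]

theorem contDiff_upperMass (r : ℝ) (d l : ℕ) : ContDiff ℝ 1 (upperMass r d l) :=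
  (ContDiff.sum fun k _ => contDiff_poissonTerm r k).add (contDiff_absorbedMass r d)

/-- Transfers between states from `l` on cancel in the sum. What is left is the inflow into state
`l` and the leak at rate `r - 1` from the transient states. -/
theorem hasDerivAt_upperMass {r : ℝ} (hr : 0 < r) {d l : ℕ} (hl : l ≤ d) (s : ℝ) :
    HasDerivAt (upperMass r d l) (poissonInflow r l s - (r - 1) * transientMass r d l s) s := by
  have h := (HasDerivAt.fun_sum fun k (_ : k ∈ Finset.Ico l d) =>
    hasDerivAt_poissonTerm r k s).add (hasDerivAt_absorbedMass hr d s)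
  refine h.congr_deriv ?_
  have htel : ∑ k ∈ Finset.Ico l d, poissonInflow r k s + poissonInflow r d s
      = poissonInflow r l s + ∑ k ∈ Finset.Ico l d, poissonTerm r k s := by
    induction d, hl using Nat.le_induction with
    | base => simp
    | succ d hd ih =>
      rw [Finset.sum_Ico_succ_top hd, Finset.sum_Ico_succ_top hd, ih
        ((HasDerivAt.fun_sum fun k _ => hasDerivAt_poissonTerm r k s).add
          (hasDerivAt_absorbedMass hr d s))]
      simp only [poissonInflow]
      ring
  rw [Finset.sum_sub_distrib, ← Finset.mul_sum, transientMass]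
  linarith

/-! ### Shortest walks from a root -/

namespace Digraph

variable {V : Type*} {G : Digraph V}

theorem Reachable.hasWalk_distance {i j : V} (h : G.Reachable i j) :
    G.HasWalk (G.distance i j) i j :=
  Nat.sInf_mem (s := {k | G.HasWalk k i j}) h

theorem HasWalk.distance_le {k : ℕ} {i j : V} (h : G.HasWalk k i j) : G.distance i j ≤ k :=
  Nat.sInf_le h

theorem Reachable.exists_parent {i j : V} (h : G.Reachable i j) {l : ℕ}
    (hl : G.distance i j = l + 1) : ∃ k, G.Adj k j ∧ G.distance i k = l := by
  have hw := h.hasWalk_distance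
  rw [hl] at hw
  obtain ⟨k, hk, hkj⟩ := hw.exists_snoc
  refine ⟨k, hkj, le_antisymm hk.distance_le ?_⟩
  have h1 := ((Reachable.hasWalk_distance ⟨l, hk⟩).snoc hkj).distance_le
  omega

theorem Reachable.distance_le_diameter [Fintype V] {i j : V} (h : G.Reachable i j) :
    G.distance i j ≤ G.diameter := by
  classical
  exact Finset.le_sup (f := fun p : V × V => G.distance p.1 p.2) (b := (i, j)) (by simpa using h)

theorem Reachable.distance_pos {i j : V} (h : G.Reachable i j) (hij : i ≠ j) :
    0 < G.distance i j := by
  refine Nat.pos_of_ne_zero fun h0 => hij ?_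
  have := h.hasWalk_distance
  rw [h0] at this
  exact this.eq_of_zero

end Digraph

theorem IntervalIntegrable.finset_inf' {κ : Type*} {P : Finset κ} (hP : P.Nonempty)
    {f : κ → ℝ → ℝ} {a b : ℝ} (h : ∀ p ∈ P, IntervalIntegrable (f p) volume a b) :
    IntervalIntegrable (fun s => P.inf' hP fun p => f p s) volume a b := by
  have : (fun s => P.inf' hP fun p => f p s) = P.inf' hP f := by
    ext s
    exact (Finset.inf'_apply hP f s).symm
  rw [this]
  refine Finset.inf'_induction hP f (p := fun g => IntervalIntegrable g volume a b) ?_ h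
  intro g₁ h₁ g₂ h₂
  rw [intervalIntegrable_iff] at h₁ h₂ ⊢
  exact Integrable.inf h₁ h₂

/-! ### Sufficiency: the chain as a subsolution, and the contraction -/

namespace SocialNetwork

variable {n : ℕ} {N : SocialNetwork n}

/-- A lower bound for the values reached from a node `c` of a network whose persistent arcs have
weights between `w` and `A w`, where `dep` is the depth of a node below `c`. -/
theorem IsSolution.absorbedMass_le (hint : N.LocallyIntegrableWeights) {t T : ℝ} (ht : 0 ≤ t)
    (hT : t ≤ T) {y : ℝ → Fin n → ℝ} (hy : N.IsSolution t y) (hy0 : ∀ i, 0 ≤ y t i)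
    {w : ℝ → ℝ} {A : ℝ} (hA : 0 ≤ A) (hw0 : ∀ s, 0 ≤ w s) (hwi : IntervalIntegrable w volume t T)
    (hwl : ∀ i j, N.persistentGraph.Adj j i → ∀ s, 0 ≤ s → w s ≤ N.coupling i j s)
    (hwu : ∀ i j, N.persistentGraph.Adj j i → ∀ s, 0 ≤ s → N.coupling i j s ≤ A * w s)
    {c : Fin n} {dep : Fin n → ℕ} {d : ℕ} (hd : d ≠ 0) (hdep : ∀ i, dep i ≤ d)
    (hdep0 : ∀ i, dep i = 0 → i = c)
    (hpar : ∀ i l, dep i = l + 1 → ∃ j, N.persistentGraph.Adj j i ∧ dep j = l)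
    {η : ℝ} (hη : 0 ≤ η) (hc : η ≤ y t c) (i : Fin n) :
    η * (Real.exp (-∫ s in t..T, N.theta s) *
      absorbedMass ((n - 1) * A + 1) d (∫ s in t..T, w s)) ≤ y T i := by
  classical
  have hn1 : (0 : ℝ) ≤ (n : ℝ) - 1 := by
    have : (1 : ℝ) ≤ n := by exact_mod_cast Fin.pos i
    linarith
  -- Total exit rate of a state: 1 forward, plus a leak covering `n - 1` arcs of weight at most `A
  -- w`.
  set r : ℝ := (n - 1) * A + 1 with hr
  have hr0 : 0 < r := by rw [hr]; positivity
  have hθi := N.intervalIntegrable_theta hint ht (ht.trans hT)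
  set e : ℝ → ℝ := fun s => Real.exp (-∫ u in t..s, N.theta u) with he
  set τ : ℝ → ℝ := fun s => ∫ u in t..s, w u with hτ
  have hτ0 : ∀ s, t ≤ s → 0 ≤ τ s := fun s hs =>
    intervalIntegral.integral_nonneg hs fun u _ => hw0 u
  have heac : AbsolutelyContinuousOnInterval e t T :=
    Real.contDiff_exp.comp_absolutelyContinuousOnInterval
      (hθi.absolutelyContinuousOnInterval_intervalIntegral left_mem_uIcc).fun_neg
  have hτac : AbsolutelyContinuousOnInterval τ t T :=
    hwi.absolutelyContinuousOnInterval_intervalIntegral left_mem_uIcc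
  have key := hy.subsolution_le hint ht hT
    (v := fun i s => η * (e s * upperMass r d (dep i) (τ s)))
    (v' := fun i s => η * (e s * -N.theta s * upperMass r d (dep i) (τ s) + e s *
      ((poissonInflow r (dep i) (τ s) - (r - 1) * transientMass r d (dep i) (τ s)) * w s)))
    (fun k => (heac.fun_mul ((contDiff_upperMass r d (dep k)).comp_absolutelyContinuousOnInterval
      hτac)).const_mul η) (fun k => ?_) (fun k => ?_) T ⟨hT, le_rfl⟩ i
  · refine le_trans ?_ key
    refine mul_le_mul_of_nonneg_left (mul_le_mul_of_nonneg_left ?_ (Real.exp_pos _).le) hη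
    exact le_add_of_nonneg_left (transientMass_nonneg r d _ (hτ0 T hT))
  · filter_upwards [hθi.ae_hasDerivAt_integral, hwi.ae_hasDerivAt_integral] with s h1 h2 hmem
    have hsI : s ∈ uIcc t T := by rw [uIcc_of_le hT]; exact ⟨hmem.1.le, hmem.2⟩
    have hs0 : 0 ≤ s := ht.trans hmem.1.le
    have hτs := hτ0 s hmem.1.le
    refine ⟨(((h1 hsI t left_mem_uIcc).neg.exp).mul ((hasDerivAt_upperMass hr0 (hdep k)
      (τ s)).comp s (h2 hsI t left_mem_uIcc))).const_mul η, ?_⟩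
    set E : ℝ := η * e s with hE
    have hE0 : 0 ≤ E := mul_nonneg hη (Real.exp_pos _).le
    set Q := absorbedMass r d (τ s) with hQ
    have hQ0 : 0 ≤ Q := absorbedMass_nonneg hr0 d hτs
    set M : ℕ → ℝ := fun l => transientMass r d l (τ s) with hM
    have hM0 : ∀ l, 0 ≤ M l := fun l => transientMass_nonneg r d l hτs
    -- `q` puts the whole forward flow into the depth of `k` on one parent arc: the values at
    -- consecutive depths `l` and `l + 1` differ by exactly `poissonTerm r l`. At depth 0 there is
    -- no flow and `q = 0`.
    obtain ⟨q, hqsum, hq⟩ : ∃ q : Fin n → ℝ,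
        ∑ j, q j = w s * (E * poissonInflow r (dep k) (τ s)) ∧
        ∀ j, q j = 0 ∨ (N.persistentGraph.Adj j k ∧
          0 ≤ M (dep j) - M (dep k) ∧ q j = w s * (E * (M (dep j) - M (dep k)))) := by
      rcases hk : dep k with _ | l
      · exact ⟨0, by simp [poissonInflow], fun j => Or.inl rfl⟩
      · obtain ⟨p, hp, hpl⟩ := hpar k l hk
        have hdiff : M l - M (l + 1) = poissonTerm r l (τ s) := by
          have := hdep k
          simp only [hM]
          rw [transientMass_eq_add r (by omega : l < d)]
          ring
        refine ⟨fun j => if j = p then w s * (E * poissonTerm r l (τ s)) else 0,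
          by simp [poissonInflow], fun j => ?_⟩
        by_cases hj : j = p
        · subst hj
          refine Or.inr ⟨hp, ?_, ?_⟩
          · rw [hpl, hdiff]
            exact poissonTerm_nonneg r l hτs
          · rw [hpl, hdiff]
            simp
        · exact Or.inl (by simp [hj])
    have hX : 0 ≤ A * w s * (E * M (dep k)) :=
      mul_nonneg (mul_nonneg hA (hw0 s)) (mul_nonneg hE0 (hM0 _))
    -- All values are at least `E * Q`, so a persistent arc that is not the parent arc pulls `k`
    -- down by at most `A w E M`. A non-persistent arc is compared with the value 0 and costs up to
    -- its weight times `E (M + Q)`.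
    have hterm : ∀ j, q j - (if j = k then 0 else A * w s * (E * M (dep k)))
        - (if N.persistentGraph.Adj j k then 0 else N.coupling k j s) * (E * (M (dep k) + Q))
        ≤ N.coupling k j s * (η * (e s * upperMass r d (dep j) (τ s))
            - η * (e s * upperMass r d (dep k) (τ s))) := by
      intro j
      have hC := N.coupling_nonneg k j s
      have hrhs : η * (e s * upperMass r d (dep j) (τ s))
            - η * (e s * upperMass r d (dep k) (τ s)) = E * (M (dep j) - M (dep k)) := by
        simp only [upperMass, hE, hM]
        ring
      rw [hrhs]
      by_cases hjk : j = k
      · subst hjk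
        have hself : ¬ N.persistentGraph.Adj j j := fun h => N.loopless j h.1
        have hqj : q j = 0 := (hq j).resolve_right fun h => hself h.1
        simp [hself, hqj, coupling_self]
      · by_cases hp : N.persistentGraph.Adj j k
        · have hl := hwl k j hp s hs0
          have hu := hwu k j hp s hs0
          simp only [hjk, hp, if_true, if_false, zero_mul, sub_zero]
          rcases hq j with hq0 | ⟨-, hnn, hqj⟩
          · rw [hq0]
            have h3 : N.coupling k j s * (E * M (dep k)) ≤ A * w s * (E * M (dep k)) :=
              mul_le_mul_of_nonneg_right hu (mul_nonneg hE0 (hM0 _))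
            have h4 : 0 ≤ N.coupling k j s * (E * M (dep j)) :=
              mul_nonneg hC (mul_nonneg hE0 (hM0 _))
            nlinarith
          · rw [hqj]
            have := mul_le_mul_of_nonneg_right hl (mul_nonneg hE0 hnn)
            linarith
        · have hqj : q j = 0 := (hq j).resolve_right fun h => hp h.1
          simp only [hjk, hp, if_false, hqj]
          have h4 : 0 ≤ N.coupling k j s * (E * M (dep j)) :=
            mul_nonneg hC (mul_nonneg hE0 (hM0 _))
          have h5 : 0 ≤ N.coupling k j s * (E * Q) := mul_nonneg hC (mul_nonneg hE0 hQ0)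
          nlinarith
    refine le_trans ?_ (Finset.sum_le_sum fun j _ => hterm j)
    rw [Finset.sum_sub_distrib, Finset.sum_sub_distrib, hqsum, ← Finset.sum_mul]
    have hcount : ∑ j : Fin n, (if j = k then 0 else A * w s * (E * M (dep k)))
        = (n - 1) * (A * w s * (E * M (dep k))) := by
      have : ∀ j : Fin n, (if j = k then 0 else A * w s * (E * M (dep k)))
          = A * w s * (E * M (dep k)) - if j = k then A * w s * (E * M (dep k)) else 0 := by
        intro j
        split_ifs <;> simp
      rw [Finset.sum_congr rfl fun j _ => this j, Finset.sum_sub_distrib]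
      simp
      ring
    rw [hcount]
    have hθ := mul_le_mul_of_nonneg_right (N.sum_nonpersistent_le_theta k hs0)
      (mul_nonneg hE0 (add_nonneg (hM0 (dep k)) hQ0))
    have hexpand : η * (e s * -N.theta s * upperMass r d (dep k) (τ s) + e s *
        ((poissonInflow r (dep k) (τ s) - (r - 1) * transientMass r d (dep k) (τ s)) * w s))
        = w s * (E * poissonInflow r (dep k) (τ s))
          - (n - 1) * (A * w s * (E * M (dep k))) - N.theta s * (E * (M (dep k) + Q)) := by
      simp only [upperMass, hE, hM, hQ, hr]
      ring
    rw [hexpand]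
    linarith
  -- At the initial time all mass is in state 0, so the subsolution is `η` at `c` and 0 elsewhere.
  · simp only [he, hτ, intervalIntegral.integral_same, neg_zero, Real.exp_zero, one_mul,
      upperMass_zero_right r hd]
    split_ifs with h
    · rw [hdep0 k h, mul_one]
      exact hc
    · simpa using hy0 k

theorem UniformlyPersistent.mul_le_integral {a τ₀ : ℝ} (h : N.UniformlyPersistent a τ₀)
    (hint : N.LocallyIntegrableWeights) (hτ₀ : 0 < τ₀) {i j : Fin n}
    (hij : N.persistentGraph.Adj j i) {t : ℝ} (ht : 0 ≤ t) (m : ℕ) :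
    m * a ≤ ∫ s in t..(t + τ₀ * m), N.coupling i j s := by
  induction m with
  | zero => simp
  | succ m ih =>
    have h0 : 0 ≤ t + τ₀ * m := by positivity
    have h1 := h i j hij _ h0
    rw [integral_weight_eq hij.1 h0 (by linarith)] at h1
    have h2 := intervalIntegral.integral_add_adjacent_intervals
      (N.intervalIntegrable_coupling hint i j t (t + τ₀ * m))
      (N.intervalIntegrable_coupling hint i j (t + τ₀ * m) (t + τ₀ * m + τ₀))
    have h3 : t + τ₀ * ((m + 1 : ℕ) : ℝ) = t + τ₀ * m + τ₀ := by push_cast; ring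
    rw [h3, ← h2]
    push_cast
    linarith

theorem omega_pos (N : SocialNetwork n) : 0 < N.omega := Real.exp_pos _

theorem omega_le_one (N : SocialNetwork n) : N.omega ≤ 1 := by
  rw [omega, Real.exp_le_one_iff, neg_nonpos]
  refine setIntegral_nonneg measurableSet_Ioi fun s hs => N.theta_nonneg (le_of_lt hs)

theorem mZero_pos (N : SocialNetwork n) {A : ℝ} (hA : 1 < A) (hn : 2 ≤ n) : 0 < N.mZero A := by
  have h1 := N.omega_pos
  have h2 : (2 : ℝ) ≤ n := by exact_mod_cast hn
  have h3 : (0 : ℝ) < n - 1 := by linarith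
  have h4 : 0 < A := by linarith
  unfold mZero
  positivity

theorem mZero_eq (N : SocialNetwork n) (A : ℝ) :
    N.mZero A = N.omega ^ 2 * (1 / (2 * (2 * ((n - 1) * A)))) := by
  unfold mZero
  rw [one_div, one_div, mul_inv 2, mul_inv 2]
  ring

/-- Since `(n - 1) A ≥ 1`, the exit rate `(n - 1) A + 1` is at most `2 (n - 1) A`. Since `omega ≤ 1`
and `d ≥ 1`, the power `omega ^ (2 d)` is at most `omega`. -/
theorem mZero_pow_le (N : SocialNetwork n) {A : ℝ} (hA : 1 < A) (hn : 2 ≤ n) {d : ℕ}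
    (hd : d ≠ 0) :
    N.mZero A ^ d ≤ N.omega * (1 / (2 * (((n : ℝ) - 1) * A + 1))) ^ d := by
  have h2 : (2 : ℝ) ≤ n := by exact_mod_cast hn
  have h3 : 1 ≤ ((n : ℝ) - 1) * A := by nlinarith
  rw [mZero_eq, mul_pow, ← pow_mul]
  have h4 : N.omega ^ (2 * d) ≤ N.omega :=
    pow_le_of_le_one N.omega_pos.le N.omega_le_one (by omega)
  have h5 : 1 / (2 * (2 * (((n : ℝ) - 1) * A))) ≤ 1 / (2 * (((n : ℝ) - 1) * A + 1)) := by
    refine one_div_le_one_div_of_le (by linarith) (by linarith)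
  exact mul_le_mul h4 (pow_le_pow_left₀ (by positivity) h5 d) (by positivity) N.omega_pos.le

theorem mZero_le_one (N : SocialNetwork n) {A : ℝ} (hA : 1 < A) (hn : 2 ≤ n) : N.mZero A ≤ 1 := by
  have h2 : (2 : ℝ) ≤ n := by exact_mod_cast hn
  have h3 : 1 ≤ ((n : ℝ) - 1) * A := by nlinarith
  have h := N.mZero_pow_le hA hn one_ne_zero
  rw [pow_one, pow_one] at h
  refine h.trans (mul_le_one₀ N.omega_le_one (by positivity) ?_)
  rw [div_le_one (by linarith)]
  linarith

/-- The lowest weight of the persistent arcs. -/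
theorem exists_persistent_floor (hint : N.LocallyIntegrableWeights) {A : ℝ}
    (hbal : N.ArcBalance A) {i₀ j₀ : Fin n} (h₀ : N.persistentGraph.Adj j₀ i₀) :
    ∃ w : ℝ → ℝ, (∀ s, 0 ≤ w s) ∧ (∀ a b, IntervalIntegrable w volume a b) ∧
      (∀ i j, N.persistentGraph.Adj j i → ∀ s, 0 ≤ s → w s ≤ N.coupling i j s) ∧
      (∀ i j, N.persistentGraph.Adj j i → ∀ s, 0 ≤ s → N.coupling i j s ≤ A * w s) ∧
      ∀ s, 0 ≤ s → A⁻¹ * N.coupling i₀ j₀ s ≤ w s := by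
  classical
  set P : Finset (Fin n × Fin n) := Finset.univ.filter fun p => N.persistentGraph.Adj p.2 p.1
    with hP
  have hne : P.Nonempty := ⟨(i₀, j₀), by simpa [hP] using h₀⟩
  have hmem : ∀ s, ∃ p : Fin n × Fin n, N.persistentGraph.Adj p.2 p.1 ∧
      (P.inf' hne fun p => N.coupling p.1 p.2 s) = N.coupling p.1 p.2 s := by
    intro s
    obtain ⟨p, hp, hps⟩ := P.exists_mem_eq_inf' hne fun p => N.coupling p.1 p.2 s
    exact ⟨p, by simpa [hP] using hp, hps⟩
  refine ⟨fun s => P.inf' hne fun p => N.coupling p.1 p.2 s, fun s => ?_, fun a b => ?_,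
    fun i j hij s _ => ?_, fun i j hij s hs => ?_, fun s hs => ?_⟩
  · obtain ⟨p, -, hps⟩ := hmem s
    simp only [hps]
    exact N.coupling_nonneg _ _ s
  · exact IntervalIntegrable.finset_inf' hne
      fun p _ => N.intervalIntegrable_coupling hint p.1 p.2 a b
  · exact Finset.inf'_le (fun p : Fin n × Fin n => N.coupling p.1 p.2 s) (b := (i, j))
      (by simpa [hP] using hij)
  · obtain ⟨p, hp, hps⟩ := hmem s
    simp only [hps]
    rw [coupling_of_adj hp.1 hs, coupling_of_adj hij.1 hs]
    exact (hbal p.1 p.2 i j hp hij s hs).2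
  · obtain ⟨p, hp, hps⟩ := hmem s
    simp only [hps]
    rw [coupling_of_adj hp.1 hs, coupling_of_adj h₀.1 hs]
    exact (hbal i₀ j₀ p.1 p.2 h₀ hp s hs).1

theorem exists_persistent_adj {c : Fin n} (hn : 2 ≤ n)
    (hc : ∀ j, N.persistentGraph.Reachable c j) :
    N.persistentGraph.diameter ≠ 0 ∧ ∃ i j, N.persistentGraph.Adj j i := by
  have : Nontrivial (Fin n) := Fin.nontrivial_iff_two_le.2 hn
  obtain ⟨i, hi⟩ := exists_ne c
  have hpos := (hc i).distance_pos hi.symm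
  refine ⟨(hpos.trans_le (hc i).distance_le_diameter).ne', ?_⟩
  obtain ⟨l, hl⟩ := Nat.exists_eq_succ_of_ne_zero hpos.ne'
  obtain ⟨j, hj, -⟩ := (hc i).exists_parent hl
  exact ⟨i, j, hj⟩

theorem IsSolution.mZero_pow_mul_le (hint : N.LocallyIntegrableWeights) {A : ℝ} (hA : 1 < A)
    (hbal : N.ArcBalance A) (hn : 2 ≤ n) {c : Fin n} (hc : ∀ j, N.persistentGraph.Reachable c j)
    {a τ₀ : ℝ} (ha : 0 < a) (hτ₀ : 0 < τ₀) (hpers : N.UniformlyPersistent a τ₀) {t : ℝ}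
    (ht : 0 ≤ t) {m : ℕ} (hm : N.persistentGraph.diameter * Real.log 2 / a ≤ m)
    {y : ℝ → Fin n → ℝ} (hy : N.IsSolution t y) (hy0 : ∀ i, 0 ≤ y t i) {η : ℝ} (hη : 0 ≤ η)
    (hyc : η ≤ y t c) (i : Fin n) :
    N.mZero A ^ N.persistentGraph.diameter * η ≤ y (t + τ₀ * m) i := by
  have hA0 : 0 < A := by linarith
  have hn2 : (2 : ℝ) ≤ n := by exact_mod_cast hn
  obtain ⟨hd, i₀, j₀, h₀⟩ := exists_persistent_adj hn hc
  obtain ⟨w, hw0, hwi, hwl, hwu, hw₀⟩ := exists_persistent_floor hint hbal h₀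
  have hT : t ≤ t + τ₀ * m := by
    have : 0 ≤ τ₀ * (m : ℝ) := by positivity
    linarith
  have key := hy.absorbedMass_le hint ht hT hy0 hA0.le hw0 (hwi _ _) hwl hwu hd
    (c := c) (dep := fun j => N.persistentGraph.distance c j)
    (fun j => (hc j).distance_le_diameter)
    (fun j hj => by
      by_contra hne
      exact ((hc j).distance_pos (Ne.symm hne)).ne' hj)
    (fun j l hl => (hc j).exists_parent hl) hη hyc i
  refine le_trans ?_ key
  set d := N.persistentGraph.diameter
  set T := t + τ₀ * m
  have hwint : A⁻¹ * (m * a) ≤ ∫ s in t..T, w s := by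
    calc A⁻¹ * (m * a) ≤ A⁻¹ * ∫ s in t..T, N.coupling i₀ j₀ s := by
          gcongr
          exact hpers.mul_le_integral hint hτ₀ h₀ ht m
      _ = ∫ s in t..T, A⁻¹ * N.coupling i₀ j₀ s := by rw [intervalIntegral.integral_const_mul]
      _ ≤ ∫ s in t..T, w s :=
          intervalIntegral.integral_mono_on hT
            ((N.intervalIntegrable_coupling hint i₀ j₀ t T).const_mul _) (hwi t T)
            fun s hs => hw₀ s (ht.trans hs.1)
  have hr0 : 0 < ((n : ℝ) - 1) * A + 1 := by nlinarith
  -- Passing from one arc to the floor `w` costs a factor `A`, which the rate `(n - 1) A + 1 ≥ A`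
  -- recovers. Hence the waiting time does not depend on `A`.
  have hclock : d * Real.log 2 ≤ (((n : ℝ) - 1) * A + 1) * ∫ s in t..T, w s := by
    have h1 : d * Real.log 2 ≤ m * a := (div_le_iff₀ ha).1 hm
    have h2 : A ≤ ((n : ℝ) - 1) * A + 1 := by nlinarith
    have h3 : (m : ℝ) * a = A * (A⁻¹ * (m * a)) := by field_simp
    have h4 : 0 ≤ A⁻¹ * (m * a) := by positivity
    calc d * Real.log 2 ≤ A * (A⁻¹ * (m * a)) := h3 ▸ h1
      _ ≤ (((n : ℝ) - 1) * A + 1) * (A⁻¹ * (m * a)) := by gcongr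
      _ ≤ _ := by gcongr
  have hQ := le_absorbedMass hr0 d hclock
  have hω : N.omega ≤ Real.exp (-∫ s in t..T, N.theta s) := by
    rw [omega, Real.exp_le_exp, neg_le_neg_iff]
    exact (integral_theta_le hint ht hT).trans (setIntegral_Ioi_theta_le hint ht)
  rw [mul_comm]
  refine mul_le_mul_of_nonneg_left ((N.mZero_pow_le hA hn hd).trans ?_) hη
  exact mul_le_mul hω hQ (by positivity) (Real.exp_pos _).le

theorem IsSolution.beliefSpread_contract (hint : N.LocallyIntegrableWeights) {A : ℝ} (hA : 1 < A)
    (hbal : N.ArcBalance A) (hn : 2 ≤ n) (hq : N.persistentGraph.QuasiStronglyConnected)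
    {a τ₀ : ℝ} (ha : 0 < a) (hτ₀ : 0 < τ₀) (hpers : N.UniformlyPersistent a τ₀) {t : ℝ}
    (ht : 0 ≤ t) {m : ℕ} (hm : N.persistentGraph.diameter * Real.log 2 / a ≤ m)
    {x : ℝ → Fin n → ℝ} (hx : N.IsSolution t x) :
    beliefSpread (x (t + τ₀ * m)) ≤
      (1 - N.mZero A ^ N.persistentGraph.diameter / 2) * beliefSpread (x t) := by
  have : Nonempty (Fin n) := ⟨⟨0, by omega⟩⟩
  obtain ⟨c, hc⟩ := hq
  have hT : t ≤ t + τ₀ * m := by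
    have : 0 ≤ τ₀ * (m : ℝ) := by positivity
    linarith
  set M := ⨆ i, x t i with hM
  set μ := ⨅ i, x t i with hμ
  have hxM : ∀ i, x t i ≤ M := le_ciSup_fin (x t)
  have hμx : ∀ i, μ ≤ x t i := ciInf_le_fin (x t)
  have hH : beliefSpread (x t) = M - μ := rfl
  have hH0 : 0 ≤ M - μ := hH ▸ beliefSpread_nonneg (x t)
  have hlo := fun i => hx.le_of_le_initial hint ht hμx hT i
  have hhi := fun i => hx.le_of_initial_le hint ht hxM hT i
  set p := N.mZero A ^ N.persistentGraph.diameter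
  rw [hH]
  -- If the root is in the lower half, all nodes are pulled away from the maximum; otherwise, from
  -- the minimum.
  rcases le_total (x t c) ((M + μ) / 2) with hcase | hcase
  · have key := fun i => (hx.const_sub M).mZero_pow_mul_le hint hA hbal hn hc ha hτ₀ hpers ht hm
      (fun i => sub_nonneg.2 (hxM i)) (η := (M - μ) / 2) (by linarith) (by linarith) i
    have := beliefSpread_le hlo (M := M - p * ((M - μ) / 2)) fun i => by linarith [key i]
    linarith
  · have key := fun i => (hx.const_add (-μ)).mZero_pow_mul_le hint hA hbal hn hc ha hτ₀ hpers ht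
      hm (fun i => by linarith [hμx i]) (η := (M - μ) / 2) (by linarith) (by linarith) i
    have := beliefSpread_le (m := μ + p * ((M - μ) / 2)) (fun i => by linarith [key i]) hhi
    linarith

end SocialNetwork

/-! ### The equivalence and the explicit rate -/

theorem theorem3 (n : ℕ) (hn : 1 ≤ n) (N : SocialNetwork n)
    (A : ℝ) (hA : 1 < A) (hbal : N.ArcBalance A)
    (hcont : N.AEContinuous) (hint : N.LocallyIntegrableWeights) :
    (N.GlobalEpsAgreement ↔
      N.persistentGraph.QuasiStronglyConnected ∧
        ∃ a τ₀ : ℝ, 0 < a ∧ 0 < τ₀ ∧ N.UniformlyPersistent a τ₀) ∧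
    (N.persistentGraph.QuasiStronglyConnected →
      ∀ a τ₀ : ℝ, 0 < a → 0 < τ₀ → N.UniformlyPersistent a τ₀ →
        ∀ t₀ : ℝ, 0 ≤ t₀ → ∀ x : ℝ → Fin n → ℝ, N.IsSolution t₀ x → ∀ t, t₀ ≤ t →
          beliefSpread
              (x (t + τ₀ * (⌈(N.persistentGraph.diameter : ℝ) * Real.log 2 / a⌉ : ℝ))) ≤
            (1 - N.mZero A ^ N.persistentGraph.diameter / 2) * beliefSpread (x t)) := by
  rcases hn.eq_or_lt with rfl | hn2
  -- With a single node the spread is identically 0, so any `ε` and `T₀` serve.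
  · refine ⟨⟨fun h => ⟨N.quasiStronglyConnected_of_agreement le_rfl hint h,
      N.uniformlyPersistent_of_agreement hA le_rfl hbal hint h⟩, fun _ =>
      ⟨1 / 2, 1, by norm_num, by norm_num, one_pos, fun t₀ _ x _ t _ => ?_⟩⟩, ?_⟩
    · simp [beliefSpread_of_subsingleton]
    · intro _ a τ₀ _ _ _ t₀ _ x _ t _
      simp [beliefSpread_of_subsingleton]
  · have hbound : N.persistentGraph.QuasiStronglyConnected →
        ∀ a τ₀ : ℝ, 0 < a → 0 < τ₀ → N.UniformlyPersistent a τ₀ →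
        ∀ t₀ : ℝ, 0 ≤ t₀ → ∀ x : ℝ → Fin n → ℝ, N.IsSolution t₀ x → ∀ t, t₀ ≤ t →
          beliefSpread
              (x (t + τ₀ * (⌈(N.persistentGraph.diameter : ℝ) * Real.log 2 / a⌉ : ℝ))) ≤
            (1 - N.mZero A ^ N.persistentGraph.diameter / 2) * beliefSpread (x t) := by
      intro hq a τ₀ ha hτ₀ hpers t₀ ht₀ x hx t ht
      have hlog : 0 ≤ Real.log 2 := Real.log_nonneg one_le_two
      obtain ⟨m, hm⟩ := Int.eq_ofNat_of_zero_le (Int.ceil_nonneg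
        (show 0 ≤ (N.persistentGraph.diameter : ℝ) * Real.log 2 / a by positivity))
      have hm' := Int.le_ceil ((N.persistentGraph.diameter : ℝ) * Real.log 2 / a)
      rw [hm, Int.cast_natCast] at hm'
      rw [hm, Int.cast_natCast]
      exact (hx.restart ht).beliefSpread_contract hint hA hbal hn2 hq ha hτ₀ hpers
        (ht₀.trans ht) hm'
    refine ⟨⟨fun h => ⟨N.quasiStronglyConnected_of_agreement hn hint h,
      N.uniformlyPersistent_of_agreement hA hn hbal hint h⟩, ?_⟩, hbound⟩
    rintro ⟨hq, a, τ₀, ha, hτ₀, hpers⟩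
    have hpow := pow_pos (N.mZero_pos hA hn2) N.persistentGraph.diameter
    have hpow1 := pow_le_one₀ (n := N.persistentGraph.diameter) (N.mZero_pos hA hn2).le
      (N.mZero_le_one hA hn2)
    refine ⟨1 - N.mZero A ^ N.persistentGraph.diameter / 2,
      τ₀ * (⌈(N.persistentGraph.diameter : ℝ) * Real.log 2 / a⌉ : ℝ), by linarith, by linarith,
      mul_pos hτ₀ ?_, hbound hq a τ₀ ha hτ₀ hpers⟩
    -- Agreement asks for `T₀ > 0`; with at least two nodes and a root the diameter is positive, and
    -- so is the ceiling.
    obtain ⟨c, hc⟩ := hq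
    have hd : 0 < N.persistentGraph.diameter :=
      Nat.pos_of_ne_zero (SocialNetwork.exists_persistent_adj hn2 hc).1
    have hlog : 0 < Real.log 2 := Real.log_pos one_lt_two
    exact_mod_cast Int.ceil_pos.2
      (show 0 < (N.persistentGraph.diameter : ℝ) * Real.log 2 / a by positivity)
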